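/- Let $\mathbb F_q$ be the finite field with $q$ elements, let $\zeta\in\mathbb F_q^\times$, and let $m$ be the multiplicative order of $\zeta$, i.e. the smallest positive integer with $\zeta^m=1$. For $n\ge 0$ put $$K_{\zeta,n}=\{(A,B)\in \mathrm{Mat}_n(\mathbb F_q)^2: AB=\zeta BA\},$$ $$U_{\zeta,n}=\{(A,B)\in K_{\zeta,n}: A \text{ nonsingular}\},\qquad N_{\zeta,n}=\{(A,B)\in K_{\zeta,n}: A\text{ nilpotent}\}.$$ Then the following identities of power series in $x$ hold (with real coefficients, infinite products converging coefficientwise). (a) $\displaystyle\sum_{n\ge0}\frac{|K_{\zeta,n}|}{|\mathrm{GL}_n(\mathbb F_q)|}x^n=\Bigl(\sum_{n\ge0}\frac{|U_{\zeta,n}|}{|\mathrm{GL}_n(\mathbb F_q)|}x^n\Bigr)\Bigl(\sum_{n\ge0}\frac{|N_{\zeta,n}|}{|\mathrm{GL}_n(\mathbb F_q)|}x^n\Bigr)$. (b) $\displaystyle\sum_{n\ge0}\frac{|U_{\zeta,n}|}{|\mathrm{GL}_n(\mathbb F_q)|}x^n=\prod_{i\ge1}G_m(x^i;q)$, where $\displaystyle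 G_m(x;q)=\frac{1-x^m}{(1-x)(1-qx^m)}$. (c) $\displaystyle\sum_{n\ge0}\frac{|N_{\zeta,n}|}{|\mathrm{GL}_n(\mathbb F_q)|}x^n=\prod_{i\ge1}H(x^i;q)$, where $\displaystyle H(x;q)=\prod_{j\ge0}\frac{1}{1-xq^{-j}}$. In particular, for every $n$, $|N_{\zeta,n}|$ does not depend on the choice of $\zeta\in\mathbb F_q^\times$. -/

import Mathlib

open PowerSeries
open scoped PowerSeries.WithPiTopology MatrixGroups

namespace ZetaCommuting

/-- `K_{ζ,n}(F)`: the pairs `(A, B)` of `n × n` matrices over `F` with `A B = ζ B A`. -/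
def K {F : Type*} [Field F] (ζ : F) (n : ℕ) :
    Set (Matrix (Fin n) (Fin n) F × Matrix (Fin n) (Fin n) F) :=
  {P | P.1 * P.2 = ζ • (P.2 * P.1)}

/-- `U_{ζ,n}(F)`: the pairs `(A, B)` in `K_{ζ,n}(F)` with `A` nonsingular. -/
def U {F : Type*} [Field F] (ζ : F) (n : ℕ) :
    Set (Matrix (Fin n) (Fin n) F × Matrix (Fin n) (Fin n) F) :=
  {P | P.1 * P.2 = ζ • (P.2 * P.1) ∧ IsUnit P.1}

/-- `N_{ζ,n}(F)`: the pairs `(A, B)` in `K_{ζ,n}(F)` with `A` nilpotent. -/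
def N {F : Type*} [Field F] (ζ : F) (n : ℕ) :
    Set (Matrix (Fin n) (Fin n) F × Matrix (Fin n) (Fin n) F) :=
  {P | P.1 * P.2 = ζ • (P.2 * P.1) ∧ IsNilpotent P.1}

/-- The power series `∑ₙ |S n| / |GLₙ(F)| xⁿ` attached to sets `S n` of pairs of
`n × n` matrices over `F`. -/
noncomputable def genFun {F : Type*} [Field F]
    (S : ∀ n : ℕ, Set (Matrix (Fin n) (Fin n) F × Matrix (Fin n) (Fin n) F)) : ℝ⟦X⟧ :=
  PowerSeries.mk fun n => (Nat.card (S n) : ℝ) / (Nat.card (GL (Fin n) F) : ℝ)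

/-- `G_m(x; q) = (1 - x^m) / ((1 - x) (1 - q x^m))`. -/
noncomputable def G (m q : ℕ) : ℝ⟦X⟧ :=
  (1 - X ^ m) * ((1 - X) * (1 - C (q : ℝ) * X ^ m))⁻¹

/-- The factor `1 / (1 - x q^{-j})` of `H(x; q)`. -/
noncomputable def HFactor (q j : ℕ) : ℝ⟦X⟧ :=
  (1 - C (((q : ℝ) ^ j)⁻¹) * X)⁻¹

/-- `H(x; q) = ∏_{j ≥ 0} 1 / (1 - x q^{-j})`, where the product is taken in `ℝ⟦X⟧` with
coefficientwise convergence in `ℝ`. -/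
noncomputable def H (q : ℕ) : ℝ⟦X⟧ :=
  ∏' j : ℕ, HFactor q j

end ZetaCommuting

/-!
All three identities come from counting orbits of the general linear group acting on pairs of
matrices by simultaneous conjugation. The counting principle is `card_mul_card_slice`: if every
point of a stable set can be moved into a slice, and the elements moving a point of the slice into
the slice form a subset `P` that does not depend on the point, then `|G| |slice| = |set| |P|`.

**The factorization of `K`** (`genFun_K_eq_mul`). If `A B = ζ B A` with `ζ ≠ 0`, then `B` preserves
the image and the kernel of every power of `A`, hence the Fitting decomposition of `A`. The pair is
therefore conjugate to a block diagonal one, built from a pair with `A` invertible and a pair with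
`A` nilpotent, uniquely up to block diagonal conjugation. Dividing by `|GLₙ|` turns this into a
product of series.

**The series of `U`** (`hasProd_expand_G`). For `A` invertible the equation says `A B A⁻¹ = ζ B`, so
`|U| / |GLₙ|` is the number of similarity classes of matrices `B` that are similar to `ζ B`
(`card_U_eq`). By the theory of elementary divisors, similarity classes correspond to sequences of
monic polynomials `g₁, g₂, …` with `∑ j deg gⱼ = n`, where `gⱼ` is the product of the `p` over all
elementary divisors `p ^ j`. The class of `B` agrees with that of `ζ B` exactly if each `gⱼ(ζ t)` is
a scalar multiple of `gⱼ(t)` (`exists_conj_eq_smul_iff`). Such a polynomial of degree `d` has free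
coefficients only at the `t ^ k` with `k < d` and `m ∣ d - k`, so there are `q ^ ⌊d / m⌋` of them
(`card_invariant_monic`), and `∑ q ^ ⌊d / m⌋ x ^ d` is `G_m(x; q)`.

That elementary divisors are an invariant is proved by counting: the sizes of the kernels of
`π(B) ^ k` for `π` irreducible determine the number of elementary divisors `π ^ k` by second
differences (`HasElementaryDivisors.card_eq_card`).

**The series of `N`** (`hasProd_expand_H`). Let `a(n, r)` be the number of pairs in `N` with `A` of
corank `r`, divided by `|GLₙ|`. The column space of `A` is preserved by `A` and `B`. If `A` has
corank `r` and size `w + r`, restricting to it gives a pair in `N` of size `w`, and the number of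
ways to recover the original pair depends only on the corank `s` of the restriction of `A`. The
result is `a(w + r, r) = ∑ₛ a(w, s) h(r - s)`, where `h(n) = ∏ (1 - q⁻ⁱ)⁻¹` over `1 ≤ i ≤ n`
(`cardCorank_recursion`). By Euler's identity (`hasProd_HFactor`), the `h(n)` are the coefficients
of `H(x; q)`, so `F(x, y) = ∑ a(n, r) xⁿ yʳ` satisfies `F(x, y) = H(x y) F(x, x y)`. Iterating from
`y = 1` gives the product of the `H(xⁱ)` (`hasProd_expand_H_of_recursion`). Since `ζ` does not occur
in the product, `|N|` does not depend on it.
-/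

namespace ZetaCommuting

/-! ### Infinite products of power series -/

/-- A product whose `i`-th factor is `1 + O(X ^ (i + 1))` converges, and the coefficient of `X ^ n`
in the limit is that in the product of the first `n` factors. -/
theorem hasProd_of_coeff_eq {f : ℕ → ℝ⟦X⟧} {L : ℝ⟦X⟧}
    (hf : ∀ i, X ^ (i + 1) ∣ f i - 1)
    (hL : ∀ n, coeff n L = coeff n (∏ i ∈ Finset.range n, f i)) : HasProd f L := by
  have key : ∀ (n : ℕ) (s : Finset ℕ), (∀ i ∈ s, n ≤ i) →
      (X : ℝ⟦X⟧) ^ (n + 1) ∣ ∏ i ∈ s, f i - 1 := by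
    intro n s
    induction s using Finset.induction_on with
    | empty => simp
    | insert a s ha ih =>
      intro h
      rw [Finset.prod_insert ha]
      have h1 : (X : ℝ⟦X⟧) ^ (n + 1) ∣ f a - 1 :=
        (pow_dvd_pow X (Nat.succ_le_succ (h a (Finset.mem_insert_self _ _)))).trans (hf a)
      have h2 := ih fun i hi => h i (Finset.mem_insert_of_mem hi)
      have : f a * ∏ i ∈ s, f i - 1 = (f a - 1) * ∏ i ∈ s, f i + (∏ i ∈ s, f i - 1) := by ring
      rw [this]
      exact dvd_add (h1.mul_right _) h2
  refine (WithPiTopology.tendsto_iff_coeff_tendsto _ _ _ _).2 fun n => ?_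
  refine tendsto_const_nhds.congr' ?_
  simp only [SummationFilter.unconditional_filter]
  filter_upwards [Filter.eventually_ge_atTop (Finset.range n)] with s hs
  have hsplit : ∏ i ∈ s, f i = (∏ i ∈ Finset.range n, f i) * ∏ i ∈ s \ Finset.range n, f i := by
    rw [mul_comm, Finset.prod_sdiff hs]
  have h3 : (X : ℝ⟦X⟧) ^ (n + 1) ∣ ∏ i ∈ s, f i - ∏ i ∈ Finset.range n, f i := by
    rw [hsplit, ← mul_sub_one]
    exact (key n (s \ Finset.range n) (by simp)).mul_left _
  have := (X_pow_dvd_iff.1 h3) n (Nat.lt_succ_self n)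
  rw [map_sub, sub_eq_zero] at this
  rw [hL, this]

theorem X_pow_dvd_expand_sub_one {f : ℝ⟦X⟧} (hf : constantCoeff f = 1) {p : ℕ} (hp : p ≠ 0) :
    X ^ p ∣ expand p hp f - 1 := by
  have h : (X : ℝ⟦X⟧) ∣ f - 1 := by rw [X_dvd_iff]; simp [hf]
  obtain ⟨g, hg⟩ := h
  exact ⟨expand p hp g, by rw [← expand_X (R := ℝ) p hp, ← map_mul, ← hg, map_sub, map_one]⟩

theorem coeff_expand_mul_eq_sum {p : ℕ} (hp : p ≠ 0) (f g : ℝ⟦X⟧) (n : ℕ) :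
    coeff n (expand p hp f * g) =
      ∑ t ∈ Finset.range (n + 1), if p * t ≤ n then coeff t f * coeff (n - p * t) g else 0 := by
  rw [coeff_mul, Finset.Nat.sum_antidiagonal_eq_sum_range_succ
    (fun i j => coeff i (expand p hp f) * coeff j g), ← Finset.sum_filter]
  symm
  refine Finset.sum_of_injOn (fun t => p * t) ?_ ?_ ?_ ?_
  · intro x _ y _ h
    exact Nat.eq_of_mul_eq_mul_left (Nat.pos_of_ne_zero hp) h
  · intro t ht
    simp only [Finset.coe_filter, Set.mem_ofPred_eq] at ht
    simpa [Nat.lt_succ_iff] using ht.2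
  · intro i hi hi'
    have : ¬ p ∣ i := by
      rintro ⟨t, rfl⟩
      apply hi'
      simp only [Finset.mem_range, Nat.lt_succ_iff] at hi
      refine ⟨t, ?_, rfl⟩
      have := Nat.le_mul_of_pos_left t (Nat.pos_of_ne_zero hp)
      simp only [Finset.coe_filter, Set.mem_ofPred_eq, Finset.mem_range]
      exact ⟨by omega, hi⟩
    rw [coeff_expand_of_not_dvd p hp _ this, zero_mul]
  · intro t _
    rw [coeff_expand_mul]

/-! ### The series `G` and `H` -/

theorem G_eq_mk {m : ℕ} (hm : 0 < m) (q : ℕ) :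
    ZetaCommuting.G m q = PowerSeries.mk fun d => (q : ℝ) ^ (d / m) := by
  have h1 : (1 - C (q : ℝ) * X ^ m) * PowerSeries.mk (fun d => (q : ℝ) ^ (d / m)) =
      ∑ d ∈ Finset.range m, X ^ d := by
    ext d
    rw [sub_mul, one_mul, map_sub, coeff_mk, mul_assoc, coeff_C_mul, coeff_X_pow_mul', map_sum]
    simp only [coeff_X_pow, Finset.sum_ite_eq, Finset.mem_range, coeff_mk]
    by_cases h : d < m
    · simp [h, Nat.div_eq_of_lt h]
    · obtain ⟨e, rfl⟩ := Nat.exists_eq_add_of_le (not_lt.1 h)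
      simp [Nat.add_div_left _ hm, pow_succ, mul_comm]
  have h2 : constantCoeff ((1 - X) * (1 - C (q : ℝ) * X ^ m)) ≠ 0 := by
    simp [hm.ne']
  rw [ZetaCommuting.G, eq_comm, PowerSeries.eq_mul_inv_iff_mul_eq h2, mul_comm, mul_assoc, h1,
    mul_comm]
  have := geom_sum_mul_neg (X : ℝ⟦X⟧) m
  exact this

/-- The coefficients `∏_{1 ≤ i ≤ n} (1 - q⁻ⁱ)⁻¹` of `H(x; q)`. -/
noncomputable def invQPoch (q n : ℕ) : ℝ :=
  ∏ i ∈ Finset.range n, (1 - ((q : ℝ) ^ (i + 1))⁻¹)⁻¹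

theorem one_sub_inv_pow_pos {q : ℕ} (hq : 1 < q) (i : ℕ) : 0 < 1 - ((q : ℝ) ^ (i + 1))⁻¹ := by
  have : (1 : ℝ) < (q : ℝ) ^ (i + 1) := one_lt_pow₀ (by exact_mod_cast hq) (Nat.succ_ne_zero i)
  exact sub_pos.2 (inv_lt_one_of_one_lt₀ this)

theorem invQPoch_pos {q : ℕ} (hq : 1 < q) (n : ℕ) : 0 < invQPoch q n :=
  Finset.prod_pos fun i _ => inv_pos.2 (one_sub_inv_pow_pos hq i)

/-- The functional equation `(1 - x) f(x) = f(x / q)`, which characterizes `H(x; q)` among series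
with constant term `1`. -/
theorem one_sub_X_mul_mk_invQPoch {q : ℕ} (hq : 1 < q) :
    (1 - X) * PowerSeries.mk (invQPoch q) = rescale ((q : ℝ)⁻¹) (PowerSeries.mk (invQPoch q)) := by
  ext n
  rw [coeff_rescale, sub_mul, one_mul, map_sub]
  cases n with
  | zero => simp
  | succ n =>
    rw [coeff_succ_X_mul]
    simp only [coeff_mk]
    have h := (one_sub_inv_pow_pos hq n).ne'
    have h3 : invQPoch q (n + 1) = invQPoch q n * (1 - ((q : ℝ) ^ (n + 1))⁻¹)⁻¹ := by
      rw [invQPoch, Finset.prod_range_succ]; rfl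
    rw [h3, inv_pow]
    have h4 : invQPoch q n * (1 - ((q : ℝ) ^ (n + 1))⁻¹)⁻¹ * (1 - ((q : ℝ) ^ (n + 1))⁻¹) =
        invQPoch q n := inv_mul_cancel_right₀ h _
    linear_combination h4

theorem one_sub_mul_rescale_mk_invQPoch {q : ℕ} (hq : 1 < q) (k : ℕ) :
    (1 - C (((q : ℝ) ^ k)⁻¹) * X) * rescale (((q : ℝ) ^ k)⁻¹) (PowerSeries.mk (invQPoch q)) =
      rescale (((q : ℝ) ^ (k + 1))⁻¹) (PowerSeries.mk (invQPoch q)) := by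
  have := congrArg (rescale (((q : ℝ) ^ k)⁻¹)) (one_sub_X_mul_mk_invQPoch hq)
  rw [map_mul, map_sub, map_one, rescale_X, rescale_rescale] at this
  rw [this, pow_succ, mul_inv, mul_comm]

theorem prod_HFactor_mul_rescale {q : ℕ} (hq : 1 < q) (k : ℕ) :
    (∏ j ∈ Finset.range k, ZetaCommuting.HFactor q j) *
      rescale (((q : ℝ) ^ k)⁻¹) (PowerSeries.mk (invQPoch q)) = PowerSeries.mk (invQPoch q) := by
  induction k with
  | zero => simp
  | succ k ih =>
    rw [Finset.prod_range_succ, ← one_sub_mul_rescale_mk_invQPoch hq, ZetaCommuting.HFactor,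
      mul_assoc, ← mul_assoc _ (1 - _), PowerSeries.inv_mul_cancel _ (by simp), one_mul, ih]

theorem HFactor_eq_mk (q j : ℕ) :
    ZetaCommuting.HFactor q j = PowerSeries.mk fun n => (((q : ℝ) ^ j)⁻¹) ^ n := by
  rw [ZetaCommuting.HFactor, eq_comm, PowerSeries.eq_inv_iff_mul_eq_one (by simp)]
  ext n
  rw [mul_sub, mul_one, map_sub, mul_comm, mul_assoc, coeff_C_mul]
  cases n with
  | zero => simp
  | succ n =>
    rw [coeff_succ_X_mul]
    simp [coeff_one, pow_succ, mul_comm]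

theorem coeff_prod_HFactor_nonneg (q : ℕ) (s : Finset ℕ) (n : ℕ) :
    0 ≤ coeff n (∏ j ∈ s, ZetaCommuting.HFactor q j) := by
  induction s using Finset.induction_on generalizing n with
  | empty => rw [Finset.prod_empty, coeff_one]; split_ifs <;> simp
  | insert a s ha ih =>
    rw [Finset.prod_insert ha, coeff_mul]
    refine Finset.sum_nonneg fun x _ => mul_nonneg ?_ (ih _)
    rw [HFactor_eq_mk, coeff_mk]
    positivity

theorem le_coeff_mul_of_nonneg {f g : ℝ⟦X⟧} (hf : ∀ n, 0 ≤ coeff n f) (hg : ∀ n, 0 ≤ coeff n g)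
    (hg1 : coeff 0 g = 1) (n : ℕ) : coeff n f ≤ coeff n (f * g) := by
  rw [coeff_mul]
  have h := Finset.single_le_sum (f := fun p : ℕ × ℕ => coeff p.1 f * coeff p.2 g)
    (fun p _ => mul_nonneg (hf p.1) (hg p.2)) (a := (n, 0))
    (Finset.HasAntidiagonal.mem_antidiagonal.2 (add_zero n))
  simpa only [hg1, mul_one] using h

theorem coeff_zero_prod_HFactor (q : ℕ) (s : Finset ℕ) :
    coeff 0 (∏ j ∈ s, ZetaCommuting.HFactor q j) = 1 := by
  rw [coeff_zero_eq_constantCoeff_apply, map_prod]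
  exact Finset.prod_eq_one fun j _ => by simp [HFactor_eq_mk, ← coeff_zero_eq_constantCoeff_apply]

/-- Euler's identity `∏_{j ≥ 0} (1 - x q⁻ʲ)⁻¹ = ∑ₙ xⁿ / ((1 - q⁻¹) ⋯ (1 - q⁻ⁿ))`. -/
theorem hasProd_HFactor {q : ℕ} (hq : 1 < q) :
    HasProd (ZetaCommuting.HFactor q) (PowerSeries.mk (invQPoch q)) := by
  -- The finite products have nonnegative coefficients that grow with the index set and stay
  -- below those of the right-hand side, hence converge; the limit is found along initial segments.
  have hmono : ∀ n, Monotone fun s : Finset ℕ => coeff n (∏ j ∈ s, ZetaCommuting.HFactor q j) := by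
    intro n s t hst
    dsimp only
    rw [← Finset.prod_sdiff hst, mul_comm]
    exact le_coeff_mul_of_nonneg (coeff_prod_HFactor_nonneg q s)
      (coeff_prod_HFactor_nonneg q _) (coeff_zero_prod_HFactor q _) n
  have hbdd : ∀ n, BddAbove (Set.range fun s : Finset ℕ =>
      coeff n (∏ j ∈ s, ZetaCommuting.HFactor q j)) := by
    intro n
    refine ⟨invQPoch q n, ?_⟩
    rintro _ ⟨s, rfl⟩
    refine (hmono n (Finset.subset_range_sup_succ s)).trans ?_
    have h := le_coeff_mul_of_nonneg (coeff_prod_HFactor_nonneg q (Finset.range (s.sup id).succ))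
      (g := rescale (((q : ℝ) ^ (s.sup id).succ)⁻¹) (PowerSeries.mk (invQPoch q)))
      (fun m => by
        rw [coeff_rescale, coeff_mk]
        exact mul_nonneg (by positivity) (invQPoch_pos hq m).le)
      (by simp [invQPoch]) n
    rwa [prod_HFactor_mul_rescale hq, coeff_mk] at h
  obtain ⟨P, hP⟩ : ∃ P : ℝ⟦X⟧, HasProd (ZetaCommuting.HFactor q) P :=
    ⟨PowerSeries.mk fun n => ⨆ s : Finset ℕ, coeff n (∏ j ∈ s, ZetaCommuting.HFactor q j),
      (WithPiTopology.tendsto_iff_coeff_tendsto _ _ _ _).2 fun n => by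
        rw [coeff_mk]
        exact tendsto_atTop_ciSup (hmono n) (hbdd n)⟩
  have h1 := hP.tendsto_prod_nat
  have h2 : Filter.Tendsto
      (fun k : ℕ => rescale (((q : ℝ) ^ k)⁻¹) (PowerSeries.mk (invQPoch q))) Filter.atTop
      (nhds 1) := by
    refine (WithPiTopology.tendsto_iff_coeff_tendsto _ _ _ _).2 fun n => ?_
    simp only [coeff_rescale, coeff_mk]
    cases n with
    | zero => simp [invQPoch]
    | succ n =>
      have h3 : Filter.Tendsto (fun k : ℕ => (((q : ℝ) ^ k)⁻¹) ^ (n + 1)) Filter.atTop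
          (nhds 0) := by
        have h4 := (tendsto_inv_atTop_zero.comp (tendsto_pow_atTop_atTop_of_one_lt
          (show (1 : ℝ) < q by exact_mod_cast hq))).pow (n + 1)
        simpa using h4
      simpa [coeff_one] using h3.mul_const (invQPoch q (n + 1))
  have h5 := h1.mul h2
  simp only [prod_HFactor_mul_rescale hq, mul_one] at h5
  rwa [← tendsto_nhds_unique tendsto_const_nhds h5] at hP

theorem H_eq_mk {q : ℕ} (hq : 1 < q) : ZetaCommuting.H q = PowerSeries.mk (invQPoch q) :=
  (hasProd_HFactor hq).tprod_eq

/-! ### From a corank recursion to the product of the `H(xⁱ)` -/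

/-- The series `F(x, xᵏ)`, where `F(x, y) = ∑ₙ ∑ᵣ a(n, r) xⁿ yʳ` and `a(n, r)` vanishes for
`r > n`. -/
noncomputable def shiftedSum (a : ℕ → ℕ → ℝ) (k : ℕ) : ℝ⟦X⟧ :=
  PowerSeries.mk fun n => ∑ r ∈ Finset.range (n + 1), if k * r ≤ n then a (n - k * r) r else 0

/-- The functional equation `F(x, y) = H(x y) F(x, x y)`, specialized to `y = xᵏ`. -/
theorem shiftedSum_eq_expand_mul {q : ℕ} {a : ℕ → ℕ → ℝ} (hlt : ∀ n r, n < r → a n r = 0)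
    (hrec : ∀ w r, a (w + r) r =
      ∑ p ∈ Finset.HasAntidiagonal.antidiagonal r, a w p.1 * invQPoch q p.2) (k : ℕ) :
    shiftedSum a k = expand (k + 1) k.succ_ne_zero (PowerSeries.mk (invQPoch q)) *
      shiftedSum a (k + 1) := by
  ext n
  -- Both sides are the sum of `a(n - (k + 1)(s + t), s) · [xᵗ] H` over all `s` and `t`.
  set T : ℕ → ℕ → ℝ := fun s t =>
    if (k + 1) * (s + t) ≤ n then a (n - (k + 1) * (s + t)) s * invQPoch q t else 0 with hT
  have hL : coeff n (shiftedSum a k) =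
      ∑ r ∈ Finset.range (n + 1), ∑ p ∈ Finset.HasAntidiagonal.antidiagonal r, T p.1 p.2 := by
    rw [shiftedSum, coeff_mk]
    refine Finset.sum_congr rfl fun r _ => ?_
    have h1 : ∀ p ∈ Finset.HasAntidiagonal.antidiagonal r, T p.1 p.2 =
        if (k + 1) * r ≤ n then a (n - (k + 1) * r) p.1 * invQPoch q p.2 else 0 := by
      intro p hp
      rw [← Finset.HasAntidiagonal.mem_antidiagonal.1 hp]
    rw [Finset.sum_congr rfl h1]
    have e : (k + 1) * r = k * r + r := by ring
    by_cases h : (k + 1) * r ≤ n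
    · have h' : k * r ≤ n := by omega
      simp only [h, h', if_true]
      rw [← hrec]
      congr 1
      omega
    · simp only [h, if_false, Finset.sum_const_zero]
      split_ifs with h2
      · exact hlt _ _ (by omega)
      · rfl
  have hR : coeff n (expand (k + 1) k.succ_ne_zero (PowerSeries.mk (invQPoch q)) *
      shiftedSum a (k + 1)) =
      ∑ t ∈ Finset.range (n + 1), ∑ s ∈ Finset.range (n + 1), T s t := by
    rw [coeff_expand_mul_eq_sum]
    refine Finset.sum_congr rfl fun t _ => ?_
    split_ifs with h
    · rw [shiftedSum, coeff_mk, coeff_mk, Finset.mul_sum]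
      have hsub : Finset.range (n - (k + 1) * t + 1) ⊆ Finset.range (n + 1) :=
        Finset.range_subset_range.2 (by omega)
      have e : ∀ s, (k + 1) * (s + t) = (k + 1) * s + (k + 1) * t := fun s => by ring
      rw [← Finset.sum_subset hsub]
      · refine Finset.sum_congr rfl fun s _ => ?_
        rw [hT]
        dsimp only
        rw [e]
        by_cases h2 : (k + 1) * s + (k + 1) * t ≤ n
        · rw [if_pos h2, if_pos (by omega), mul_comm]
          congr 2
          omega
        · rw [if_neg h2, if_neg (by omega), mul_zero]
      · intro s _ hs
        have h3 : s ≤ (k + 1) * s := Nat.le_mul_of_pos_left s k.succ_pos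
        rw [Finset.mem_range] at hs
        exact if_neg (by rw [e]; omega)
    · symm
      refine Finset.sum_eq_zero fun s _ => if_neg ?_
      have : (k + 1) * (s + t) = (k + 1) * s + (k + 1) * t := by ring
      omega
  rw [hL, hR, Finset.sum_comm, ← Finset.sum_product',
    Finset.sum_sigma' (Finset.range (n + 1)) (fun r => Finset.HasAntidiagonal.antidiagonal r)
      (fun _ p => T p.1 p.2)]
  refine Finset.sum_of_injOn (fun x => x.2) ?_ ?_ ?_ ?_
  · rintro ⟨r, p⟩ hx ⟨r', p'⟩ hy h
    simp only [Finset.coe_sigma, Set.mem_sigma_iff, Finset.mem_coe,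
      Finset.HasAntidiagonal.mem_antidiagonal] at hx hy h
    subst h
    obtain rfl : r = r' := hx.2.symm.trans hy.2
    rfl
  · rintro ⟨r, p⟩ hx
    simp only [Finset.coe_sigma, Set.mem_sigma_iff, Finset.mem_coe,
      Finset.HasAntidiagonal.mem_antidiagonal, Finset.mem_range] at hx
    simp only [Finset.coe_product, Set.mem_prod, Finset.mem_coe, Finset.mem_range]
    omega
  · rintro p _ hp
    refine if_neg fun hle => hp ⟨⟨p.1 + p.2, p⟩, ?_, rfl⟩
    have h3 : p.1 + p.2 ≤ (k + 1) * (p.1 + p.2) := Nat.le_mul_of_pos_left _ k.succ_pos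
    simp only [Finset.coe_sigma, Set.mem_sigma_iff, Finset.mem_coe,
      Finset.HasAntidiagonal.mem_antidiagonal, Finset.mem_range, and_true]
    omega
  · intro x _
    rfl

/-- If `F(x, y) = ∑ₙ ∑ᵣ a(n, r) xⁿ yʳ` satisfies `F(x, y) = H(x y) F(x, x y)` and `F(x, 0) = 1`,
then `F(x, 1) = ∏_{i ≥ 1} H(xⁱ)`. -/
theorem hasProd_expand_H_of_recursion {q : ℕ} (hq : 1 < q) {a : ℕ → ℕ → ℝ} (h00 : a 0 0 = 1)
    (h0 : ∀ n, n ≠ 0 → a n 0 = 0) (hlt : ∀ n r, n < r → a n r = 0)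
    (hrec : ∀ w r, a (w + r) r =
      ∑ p ∈ Finset.HasAntidiagonal.antidiagonal r, a w p.1 * invQPoch q p.2) :
    HasProd (fun i : ℕ => expand (i + 1) i.succ_ne_zero (ZetaCommuting.H q))
      (PowerSeries.mk fun n => ∑ r ∈ Finset.range (n + 1), a n r) := by
  have hS0 : (PowerSeries.mk fun n => ∑ r ∈ Finset.range (n + 1), a n r) = shiftedSum a 0 := by
    simp [shiftedSum]
  have hone : ∀ k, X ^ (k + 1) ∣ shiftedSum a k - 1 := by
    intro k
    refine X_pow_dvd_iff.2 fun n hn => ?_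
    rw [map_sub, shiftedSum, coeff_mk, Finset.sum_range_succ', Finset.sum_eq_zero]
    · by_cases hn0 : n = 0
      · simp [hn0, h00, coeff_one]
      · simp [hn0, h0, coeff_one]
    · intro r _
      split_ifs with h
      · refine hlt _ _ ?_
        have : k * (r + 1) = k * r + k := by ring
        omega
      · rfl
  have hprod : ∀ k, shiftedSum a 0 = (∏ i ∈ Finset.range k,
      expand (i + 1) i.succ_ne_zero (ZetaCommuting.H q)) * shiftedSum a k := by
    intro k
    induction k with
    | zero => simp
    | succ k ih =>
      rw [Finset.prod_range_succ, mul_assoc, H_eq_mk hq, ← shiftedSum_eq_expand_mul hlt hrec, ih,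
        H_eq_mk hq]
  rw [hS0]
  refine hasProd_of_coeff_eq (fun i => X_pow_dvd_expand_sub_one ?_ _) fun k => ?_
  · simp [H_eq_mk hq, invQPoch, ← coeff_zero_eq_constantCoeff_apply]
  · rw [← sub_eq_zero, ← map_sub, hprod k, ← mul_sub_one]
    exact X_pow_dvd_iff.1 ((hone k).mul_left _) k (Nat.lt_succ_self k)

/-! ### Counting orbits through a slice -/

/-- If every element of the `G`-stable set `S` can be moved into the slice `S₀`, and `P` is the set
of group elements moving a given (equivalently any) element of `S₀` into `S₀`, then
`|G| |S₀| = |S| |P|`. -/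
theorem card_mul_card_slice {G X : Type*} [Group G] (φ : G →* Equiv.Perm X)
    {S S₀ : Set X} {P : Set G} (hS : ∀ g, ∀ s ∈ S, φ g s ∈ S) (h₀ : S₀ ⊆ S)
    (hex : ∀ s ∈ S, ∃ g, φ g s ∈ S₀) (hP : ∀ s ∈ S₀, ∀ g, φ g s ∈ S₀ ↔ g ∈ P) :
    Nat.card G * Nat.card S₀ = Nat.card S * Nat.card P := by
  choose! γ hγ using hex
  have hmul : ∀ g h s, φ g (φ h s) = φ (g * h) s := fun g h s => by rw [map_mul]; rfl
  have hinv : ∀ g s, φ g⁻¹ (φ g s) = s := fun g s => by rw [hmul]; simp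
  have hinv' : ∀ g s, φ g (φ g⁻¹ s) = s := fun g s => by rw [hmul]; simp
  rw [← Nat.card_prod, ← Nat.card_prod]
  refine Nat.card_congr
    { toFun := fun x => (⟨φ x.1⁻¹ x.2, hS _ _ (h₀ x.2.2)⟩, ⟨x.1 * (γ (φ x.1⁻¹ x.2))⁻¹, ?_⟩)
      invFun := fun y => (y.2 * γ y.1, ⟨φ y.2 (φ (γ y.1) y.1), ?_⟩)
      left_inv := ?_
      right_inv := ?_ }
  · rw [← hP _ (hγ _ (hS x.1⁻¹ _ (h₀ x.2.2))), hmul, mul_assoc, inv_mul_cancel, mul_one, hinv']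
    exact x.2.2
  · exact (hP _ (hγ _ y.1.2) _).2 y.2.2
  · rintro ⟨g, s, hs⟩
    ext
    · simp
    · simp only [hmul]
      simp
  · rintro ⟨⟨s, hs⟩, ⟨p, hp⟩⟩
    have : φ (p * γ s)⁻¹ (φ p (φ (γ s) s)) = s := by rw [hmul p, hinv]
    ext
    · exact this
    · simp only [this]
      simp

section Conj

variable {F : Type*} [Field F] {ι : Type*} [Fintype ι] [DecidableEq ι]

/-- Simultaneous conjugation of pairs of matrices. -/
def conjPair : GL ι F →* Equiv.Perm (Matrix ι ι F × Matrix ι ι F) where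
  toFun g :=
    { toFun := fun P => (g.1 * P.1 * g⁻¹.1, g.1 * P.2 * g⁻¹.1)
      invFun := fun P => (g⁻¹.1 * P.1 * g.1, g⁻¹.1 * P.2 * g.1)
      left_inv := fun P => by simp [mul_assoc]
      right_inv := fun P => by simp [mul_assoc] }
  map_one' := by ext P <;> simp
  map_mul' g h := by ext P <;> simp [mul_assoc]

@[simp] theorem conjPair_fst (g : GL ι F) (P : Matrix ι ι F × Matrix ι ι F) :
    (conjPair g P).1 = g.1 * P.1 * g⁻¹.1 := rfl

@[simp] theorem conjPair_snd (g : GL ι F) (P : Matrix ι ι F × Matrix ι ι F) :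
    (conjPair g P).2 = g.1 * P.2 * g⁻¹.1 := rfl

theorem conj_mul_conj (g : GL ι F) (A B : Matrix ι ι F) :
    (g.1 * A * g⁻¹.1) * (g.1 * B * g⁻¹.1) = g.1 * (A * B) * g⁻¹.1 := by
  simp only [mul_assoc, Units.inv_mul_cancel_left]

theorem conj_matrix_pow (g : GL ι F) (A : Matrix ι ι F) (k : ℕ) :
    (g.1 * A * g⁻¹.1) ^ k = g.1 * A ^ k * g⁻¹.1 := by
  induction k with
  | zero => simp
  | succ k ih => rw [pow_succ, ih, conj_mul_conj, pow_succ]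

theorem conj_zetaCommute {ζ : F} (g : GL ι F) {A B : Matrix ι ι F} (h : A * B = ζ • (B * A)) :
    (g.1 * A * g⁻¹.1) * (g.1 * B * g⁻¹.1) =
      ζ • ((g.1 * B * g⁻¹.1) * (g.1 * A * g⁻¹.1)) := by
  rw [conj_mul_conj, conj_mul_conj, h, Matrix.mul_smul, Matrix.smul_mul]

theorem rank_conj (g : GL ι F) (A : Matrix ι ι F) : (g.1 * A * g⁻¹.1).rank = A.rank := by
  rw [Matrix.rank_mul_eq_left_of_isUnit_det _ _ ((Matrix.isUnit_iff_isUnit_det _).1 g⁻¹.isUnit),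
    Matrix.rank_mul_eq_right_of_isUnit_det _ _ ((Matrix.isUnit_iff_isUnit_det _).1 g.isUnit)]

theorem isNilpotent_conj (g : GL ι F) {A : Matrix ι ι F} (h : IsNilpotent A) :
    IsNilpotent (g.1 * A * g⁻¹.1) := by
  obtain ⟨k, hk⟩ := h
  exact ⟨k, by rw [conj_matrix_pow, hk, mul_zero, zero_mul]⟩

end Conj

/-! ### Block decompositions -/

section Blocks

open Matrix Module

variable {F : Type*} [Field F] {a b : ℕ}

theorem exists_GL_mulVec_eq {ι : Type*} [Fintype ι] [DecidableEq ι] (e : (ι → F) ≃ₗ[F] (ι → F)) :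
    ∃ g : GL ι F, ∀ v, g.1 *ᵥ v = e v :=
  ⟨⟨LinearMap.toMatrix' e.toLinearMap, LinearMap.toMatrix' e.symm.toLinearMap,
      by rw [← LinearMap.toMatrix'_comp]; simp, by rw [← LinearMap.toMatrix'_comp]; simp⟩,
    fun v => by
      change LinearMap.toMatrix' e.toLinearMap *ᵥ v = e v
      rw [LinearMap.toMatrix'_mulVec]; rfl⟩

/-- Complementary subspaces can be moved to the two coordinate subspaces. -/
theorem exists_GL_of_isCompl {W₁ W₂ : Submodule F (Fin a ⊕ Fin b → F)} (h : IsCompl W₁ W₂)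
    (h₁ : finrank F W₁ = a) :
    ∃ g : GL (Fin a ⊕ Fin b) F, (∀ v, v ∈ W₁ ↔ ∀ j, (g.1 *ᵥ v) (Sum.inr j) = 0) ∧
      ∀ v, v ∈ W₂ ↔ ∀ i, (g.1 *ᵥ v) (Sum.inl i) = 0 := by
  have h₂ : finrank F W₂ = b := by
    have := Submodule.finrank_add_eq_of_isCompl h
    simp only [finrank_fintype_fun_eq_card, Fintype.card_sum, Fintype.card_fin] at this
    omega
  let e₁ : W₁ ≃ₗ[F] (Fin a → F) := LinearEquiv.ofFinrankEq _ _ (by simp [h₁])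
  let e₂ : W₂ ≃ₗ[F] (Fin b → F) := LinearEquiv.ofFinrankEq _ _ (by simp [h₂])
  let e : (Fin a ⊕ Fin b → F) ≃ₗ[F] (Fin a ⊕ Fin b → F) :=
    (Submodule.prodEquivOfIsCompl W₁ W₂ h).symm ≪≫ₗ (e₁.prodCongr e₂) ≪≫ₗ
      (LinearEquiv.sumArrowLequivProdArrow (Fin a) (Fin b) F F).symm
  obtain ⟨g, hg⟩ := exists_GL_mulVec_eq e
  refine ⟨g, fun v => ?_, fun v => ?_⟩
  · rw [← Submodule.prodEquivOfIsCompl_symm_apply_snd_eq_zero _ _ h, ← e₂.map_eq_zero_iff,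
      funext_iff]
    simp only [hg]
    rfl
  · rw [← Submodule.prodEquivOfIsCompl_symm_apply_fst_eq_zero _ _ h, ← e₁.map_eq_zero_iff,
      funext_iff]
    simp only [hg]
    rfl

/-- A matrix that preserves `W` has vanishing lower left block once `W` has been moved to the first
coordinate subspace. -/
theorem apply_inr_inl_conj_eq_zero {W : Submodule F (Fin a ⊕ Fin b → F)}
    {g : GL (Fin a ⊕ Fin b) F} (hg : ∀ v, v ∈ W ↔ ∀ j, (g.1 *ᵥ v) (Sum.inr j) = 0)
    {A : Matrix (Fin a ⊕ Fin b) (Fin a ⊕ Fin b) F} (hA : ∀ v ∈ W, A *ᵥ v ∈ W) :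
    (g.1 * A * g⁻¹.1).toBlocks₂₁ = 0 := by
  ext j i
  have h1 : g⁻¹.1 *ᵥ Pi.single (Sum.inl i) 1 ∈ W := by
    rw [hg, mulVec_mulVec, Units.mul_inv]
    simp
  have h2 := (hg _).1 (hA _ h1) j
  rw [mulVec_mulVec, mulVec_mulVec] at h2
  simpa [toBlocks₂₁] using h2

theorem apply_inl_inr_conj_eq_zero {W : Submodule F (Fin a ⊕ Fin b → F)}
    {g : GL (Fin a ⊕ Fin b) F} (hg : ∀ v, v ∈ W ↔ ∀ i, (g.1 *ᵥ v) (Sum.inl i) = 0)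
    {A : Matrix (Fin a ⊕ Fin b) (Fin a ⊕ Fin b) F} (hA : ∀ v ∈ W, A *ᵥ v ∈ W) :
    (g.1 * A * g⁻¹.1).toBlocks₁₂ = 0 := by
  ext i j
  have h1 : g⁻¹.1 *ᵥ Pi.single (Sum.inr j) 1 ∈ W := by
    rw [hg, mulVec_mulVec, Units.mul_inv]
    simp
  have h2 := (hg _).1 (hA _ h1) i
  rw [mulVec_mulVec, mulVec_mulVec] at h2
  simpa [toBlocks₁₂] using h2

/-- Fitting decomposition of an endomorphism; the image and the kernel of its powers are stable from
the dimension on. -/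
theorem isCompl_range_pow_ker_pow {V : Type*} [AddCommGroup V] [Module F V] [FiniteDimensional F V]
    (f : End F V) {n : ℕ} (hn : finrank F V ≤ n) :
    IsCompl (LinearMap.range (f ^ n)) (LinearMap.ker (f ^ n)) := by
  rw [Submodule.isCompl_iff_disjoint _ _ (LinearMap.finrank_range_add_finrank_ker (f ^ n)).ge,
    Submodule.disjoint_def]
  rintro x ⟨y, rfl⟩ hx
  have h1 : y ∈ LinearMap.ker (f ^ (n + n)) := by
    rw [LinearMap.mem_ker, pow_add]
    exact hx
  rw [End.ker_pow_eq_ker_pow_finrank_of_le (by omega), ← End.ker_pow_eq_ker_pow_finrank_of_le hn]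
    at h1
  exact h1

variable {ι κ : Type*} [Fintype ι] [DecidableEq ι] [Fintype κ] [DecidableEq κ]

/-- The Sylvester equation `T Y = X T` with `X` invertible and `Y` nilpotent has only the zero
solution. -/
theorem eq_zero_of_mul_isNilpotent_eq_isUnit_mul {X : Matrix ι ι F} {Y : Matrix κ κ F}
    {T : Matrix ι κ F} (hX : IsUnit X) (hY : IsNilpotent Y) (h : T * Y = X * T) : T = 0 := by
  obtain ⟨k, hk⟩ := hY
  have h1 : ∀ k, T * Y ^ k = X ^ k * T := by
    intro k
    induction k with
    | zero => simp
    | succ k ih => rw [pow_succ, ← Matrix.mul_assoc, ih, Matrix.mul_assoc, h, ← Matrix.mul_assoc,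
        pow_succ]
  have h2 := h1 k
  rw [hk, Matrix.mul_zero] at h2
  obtain ⟨u, hu⟩ := hX.pow k
  rw [← hu] at h2
  calc T = u⁻¹.1 * (u.1 * T) := by rw [← Matrix.mul_assoc, Units.inv_mul, Matrix.one_mul]
    _ = 0 := by rw [← h2, Matrix.mul_zero]

theorem eq_zero_of_isNilpotent_mul_eq_mul_isUnit {X : Matrix ι ι F} {Y : Matrix κ κ F}
    {T : Matrix κ ι F} (hX : IsUnit X) (hY : IsNilpotent Y) (h : Y * T = T * X) : T = 0 := by
  have := eq_zero_of_mul_isNilpotent_eq_isUnit_mul (X := Xᵀ) (Y := Yᵀ) (T := Tᵀ)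
    (by rwa [isUnit_transpose]) (by
      obtain ⟨k, hk⟩ := hY
      exact ⟨k, by rw [← transpose_pow, hk, transpose_zero]⟩)
    (by rw [← transpose_mul, h, transpose_mul])
  simpa using this

theorem rank_fromBlocks_isUnit_zero {X : Matrix ι ι F} (hX : IsUnit X) :
    (fromBlocks X 0 0 (0 : Matrix κ κ F)).rank = Fintype.card ι := by
  classical
  have h1 : fromBlocks X 0 0 (0 : Matrix κ κ F) =
      fromBlocks X 0 0 1 * diagonal (Sum.elim (fun _ => 1) fun _ => 0) := by
    rw [← fromBlocks_diagonal, fromBlocks_multiply]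
    simp
  rw [h1, rank_mul_eq_right_of_isUnit_det _ _ ((isUnit_iff_isUnit_det _).1
    (isUnit_fromBlocks_zero₂₁.2 ⟨hX, isUnit_one⟩)), rank_diagonal]
  refine Fintype.card_congr ⟨fun x => match x with
    | ⟨Sum.inl i, _⟩ => i
    | ⟨Sum.inr j, h⟩ => (h rfl).elim, fun i => ⟨Sum.inl i, one_ne_zero⟩, ?_, fun i => rfl⟩
  rintro ⟨i | j, h⟩
  · rfl
  · exact (h rfl).elim

end Blocks

/-! ### Splitting off the invertible part -/

section BlockUpper

open Matrix Module

variable {F : Type*} [Field F] {ι κ : Type*} [Fintype ι] [DecidableEq ι] [Fintype κ] [DecidableEq κ]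

/-- The invertible block upper triangular matrix with given diagonal blocks and corner. -/
noncomputable def blockUpper (x : GL ι F × GL κ F × Matrix ι κ F) : GL (ι ⊕ κ) F :=
  (isUnit_fromBlocks_zero₂₁.2 ⟨x.1.isUnit, x.2.1.isUnit⟩ :
    IsUnit (fromBlocks x.1.1 x.2.2 0 x.2.1.1)).unit

theorem blockUpper_val (x : GL ι F × GL κ F × Matrix ι κ F) :
    (blockUpper x).1 = fromBlocks x.1.1 x.2.2 0 x.2.1.1 := rfl

theorem blockUpper_injective :
    Function.Injective (blockUpper : GL ι F × GL κ F × Matrix ι κ F → GL (ι ⊕ κ) F) := by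
  rintro ⟨g, h, T⟩ ⟨g', h', T'⟩ e
  have := congrArg Units.val e
  rw [blockUpper_val, blockUpper_val, fromBlocks_inj] at this
  obtain ⟨h1, h2, -, h3⟩ := this
  simp only [Prod.mk.injEq]
  exact ⟨Units.ext h1, Units.ext h3, h2⟩

theorem exists_blockUpper_eq {g : GL (ι ⊕ κ) F} (hg : g.1.toBlocks₂₁ = 0) :
    ∃ h₁ h₂, g = blockUpper (h₁, h₂, g.1.toBlocks₁₂) := by
  have h : g.1 = fromBlocks g.1.toBlocks₁₁ g.1.toBlocks₁₂ 0 g.1.toBlocks₂₂ := by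
    rw [← hg, fromBlocks_toBlocks]
  have hu := g.isUnit
  rw [h, isUnit_fromBlocks_zero₂₁] at hu
  exact ⟨hu.1.unit, hu.2.unit, Units.ext h⟩

theorem blockUpper_zero_conj (h₁ : GL ι F) (h₂ : GL κ F) (X : Matrix ι ι F) (Y : Matrix κ κ F) :
    (blockUpper (h₁, h₂, 0)).1 * fromBlocks X 0 0 Y * (blockUpper (h₁, h₂, 0))⁻¹.1 =
      fromBlocks (h₁.1 * X * h₁⁻¹.1) 0 0 (h₂.1 * Y * h₂⁻¹.1) := by
  have h : (blockUpper (h₁, h₂, 0))⁻¹.1 = fromBlocks h₁⁻¹.1 0 0 h₂⁻¹.1 := by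
    have h' : blockUpper (h₁, h₂, 0) * blockUpper (h₁⁻¹, h₂⁻¹, (0 : Matrix ι κ F)) = 1 := by
      apply Units.ext
      rw [Units.val_mul, blockUpper_val, blockUpper_val, fromBlocks_multiply]
      simp
    rw [inv_eq_of_mul_eq_one_right h', blockUpper_val]
  rw [h, blockUpper_val, fromBlocks_multiply, fromBlocks_multiply]
  simp

end BlockUpper

section Fitting

open Matrix Module

variable {F : Type*} [Field F]

/-- The block diagonal pair built from a pair in `U` and a pair in `N`. -/
def blockPair {ζ : F} {a b : ℕ} (x : U ζ a × N ζ b) :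
    Matrix (Fin a ⊕ Fin b) (Fin a ⊕ Fin b) F × Matrix (Fin a ⊕ Fin b) (Fin a ⊕ Fin b) F :=
  (fromBlocks x.1.1.1 0 0 x.2.1.1, fromBlocks x.1.1.2 0 0 x.2.1.2)

theorem blockPair_injective {ζ : F} {a b : ℕ} :
    Function.Injective (blockPair : U ζ a × N ζ b → _) := by
  rintro ⟨⟨⟨X, Z⟩, _⟩, ⟨⟨Y, W⟩, _⟩⟩ ⟨⟨⟨X', Z'⟩, _⟩, ⟨⟨Y', W'⟩, _⟩⟩ h
  simp only [blockPair, Prod.mk.injEq, fromBlocks_inj] at h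
  obtain ⟨⟨rfl, -, -, rfl⟩, rfl, -, -, rfl⟩ := h
  rfl

theorem pow_eq_zero_of_isNilpotent {b n : ℕ} (hn : b ≤ n) {Y : Matrix (Fin b) (Fin b) F}
    (hY : IsNilpotent Y) : Y ^ n = 0 := by
  have h : Y ^ b = 0 := by
    have h1 := Matrix.isNilpotent_charpoly_sub_pow_of_isNilpotent hY
    rw [isNilpotent_iff_eq_zero, sub_eq_zero, Fintype.card_fin] at h1
    have h2 := Matrix.aeval_self_charpoly Y
    rwa [h1, map_pow, Polynomial.aeval_X] at h2
  exact pow_eq_zero_of_le hn h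

/-- A pair with `A B = ζ B A` preserves the Fitting decomposition of `A`, so it is conjugate to a
block diagonal pair built from a pair in `U` and a pair in `N`; two such block diagonal pairs are
conjugate only through block diagonal matrices. -/
theorem card_fitting_slice {ζ : F} (hζ : ζ ≠ 0) (a b : ℕ) :
    Nat.card (GL (Fin a ⊕ Fin b) F) * (Nat.card (U ζ a) * Nat.card (N ζ b)) =
      Nat.card {P : Matrix (Fin a ⊕ Fin b) (Fin a ⊕ Fin b) F ×
          Matrix (Fin a ⊕ Fin b) (Fin a ⊕ Fin b) F |
        P.1 * P.2 = ζ • (P.2 * P.1) ∧ (P.1 ^ (a + b)).rank = a} *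
      (Nat.card (GL (Fin a) F) * Nat.card (GL (Fin b) F)) := by
  have hinj : Function.Injective
      fun h : GL (Fin a) F × GL (Fin b) F => blockUpper (h.1, h.2, (0 : Matrix _ _ F)) := by
    rintro ⟨g, h⟩ ⟨g', h'⟩ e
    have := blockUpper_injective e
    simp only [Prod.mk.injEq, and_true] at this
    exact Prod.ext this.1 this.2
  have key := card_mul_card_slice (conjPair (F := F) (ι := Fin a ⊕ Fin b))
    (S := {P | P.1 * P.2 = ζ • (P.2 * P.1) ∧ (P.1 ^ (a + b)).rank = a})
    (S₀ := Set.range (blockPair (ζ := ζ) (a := a) (b := b)))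
    (P := Set.range fun h : GL (Fin a) F × GL (Fin b) F =>
      blockUpper (h.1, h.2, (0 : Matrix _ _ F))) ?_ ?_ ?_ ?_
  · rwa [Nat.card_range_of_injective blockPair_injective, Nat.card_range_of_injective hinj,
      Nat.card_prod, Nat.card_prod] at key
  · rintro g P ⟨h1, h2⟩
    exact ⟨conj_zetaCommute g h1, by rw [conjPair_fst, conj_matrix_pow, rank_conj, h2]⟩
  · rintro _ ⟨⟨⟨⟨X, Z⟩, hXZ, hX⟩, ⟨⟨Y, W⟩, hYW, hY⟩⟩, rfl⟩
    refine ⟨?_, ?_⟩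
    · simp only [blockPair] at hXZ hYW ⊢
      rw [fromBlocks_multiply, fromBlocks_multiply, fromBlocks_smul]
      simp [hXZ, hYW]
    · simp only [blockPair]
      rw [fromBlocks_diagonal_pow, pow_eq_zero_of_isNilpotent (Nat.le_add_left b a) hY,
        rank_fromBlocks_isUnit_zero (hX.pow _), Fintype.card_fin]
  · rintro ⟨A, B⟩ ⟨hAB, hr⟩
    -- Move the image and the kernel of `A ^ (a + b)` to the coordinate subspaces.
    set f := toLin' A with hf
    have hpow : ∀ k v, (f ^ k) v = (A ^ k) *ᵥ v := by
      intro k v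
      rw [hf, ← toLin'_pow, toLin'_apply]
    have hc := isCompl_range_pow_ker_pow f (n := a + b) (by simp)
    obtain ⟨g, hg₁, hg₂⟩ := exists_GL_of_isCompl hc (by
      rw [hf, ← toLin'_pow]; exact hr)
    have hcomm : ∀ k, A ^ k * B = ζ ^ k • (B * A ^ k) := by
      intro k
      induction k with
      | zero => simp
      | succ k ih =>
        rw [pow_succ, mul_assoc, hAB, Matrix.mul_smul, ← mul_assoc, ih, Matrix.smul_mul, smul_smul,
          mul_assoc, pow_succ']
    have hA21 : (g.1 * A * g⁻¹.1).toBlocks₂₁ = 0 := by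
      refine apply_inr_inl_conj_eq_zero hg₁ ?_
      rintro _ ⟨w, rfl⟩
      exact ⟨A *ᵥ w, by rw [hpow, hpow, mulVec_mulVec, mulVec_mulVec, ← pow_succ, pow_succ']⟩
    have hA12 : (g.1 * A * g⁻¹.1).toBlocks₁₂ = 0 := by
      refine apply_inl_inr_conj_eq_zero hg₂ fun v hv => ?_
      rw [LinearMap.mem_ker, hpow] at hv ⊢
      rw [mulVec_mulVec, ← pow_succ, pow_succ', ← mulVec_mulVec, hv, mulVec_zero]
    set A' := g.1 * A * g⁻¹.1 with hA'
    set B' := g.1 * B * g⁻¹.1 with hB'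
    have hAb : A' = fromBlocks A'.toBlocks₁₁ 0 0 A'.toBlocks₂₂ := by
      conv_lhs => rw [← fromBlocks_toBlocks A', hA21, hA12]
    -- A vector killed by the first block lies in the image and in the kernel of `A ^ (a + b)`.
    have hX : IsUnit A'.toBlocks₁₁ := by
      rw [← mulVec_injective_iff_isUnit, ← coe_mulVecLin, ← LinearMap.ker_eq_bot,
        LinearMap.ker_eq_bot']
      intro v hv
      rw [mulVecLin_apply] at hv
      have h1 : A' *ᵥ (Sum.elim v 0) = 0 := by
        rw [hAb, fromBlocks_mulVec]
        simp [hv]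
      have h2 : g⁻¹.1 *ᵥ Sum.elim v 0 ∈ LinearMap.range (f ^ (a + b)) := by
        rw [hg₁, mulVec_mulVec, Units.mul_inv]; simp
      have h4 : A *ᵥ (g⁻¹.1 *ᵥ Sum.elim v 0) = 0 := by
        have h5 : g.1 *ᵥ (A *ᵥ (g⁻¹.1 *ᵥ Sum.elim v 0)) = 0 := by
          rw [mulVec_mulVec, mulVec_mulVec, h1]
        have h6 := congrArg (fun x => g⁻¹.1 *ᵥ x) h5
        simpa using h6
      have h3 : g⁻¹.1 *ᵥ Sum.elim v 0 ∈ LinearMap.ker (f ^ (a + b)) := by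
        rcases eq_or_ne (a + b) 0 with h | h
        · have : IsEmpty (Fin a ⊕ Fin b) := by
            rw [← Fintype.card_eq_zero_iff]; simpa using h
          rw [Subsingleton.elim (g⁻¹.1 *ᵥ Sum.elim v 0) 0]
          exact zero_mem _
        · obtain ⟨k, hk⟩ := Nat.exists_eq_succ_of_ne_zero h
          rw [LinearMap.mem_ker, hpow, hk, pow_succ, ← mulVec_mulVec, h4, mulVec_zero]
      have h7 := Submodule.disjoint_def.1 hc.disjoint _ h2 h3
      have h8 := congrArg (fun x => g.1 *ᵥ x) h7
      simp only [mulVec_mulVec, Units.mul_inv, one_mulVec, mulVec_zero] at h8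
      funext i
      exact congrFun h8 (Sum.inl i)
    have hY : IsNilpotent A'.toBlocks₂₂ := by
      refine ⟨a + b, ?_⟩
      have h1 : A' ^ (a + b) = fromBlocks (A'.toBlocks₁₁ ^ (a + b)) 0 0
          (A'.toBlocks₂₂ ^ (a + b)) := by
        conv_lhs => rw [hAb]
        rw [fromBlocks_diagonal_pow]
      ext i j
      have h2 : g⁻¹.1 *ᵥ Pi.single (Sum.inr j) 1 ∈ LinearMap.ker (f ^ (a + b)) := by
        rw [hg₂, mulVec_mulVec, Units.mul_inv]; simp
      rw [LinearMap.mem_ker, hpow] at h2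
      have h3 := congrFun (congrArg (fun x => g.1 *ᵥ x) h2) (Sum.inr i)
      simp only [mulVec_mulVec] at h3
      rw [← mul_assoc, ← conj_matrix_pow, ← hA', h1] at h3
      simpa using h3
    have hAB' : A' * B' = ζ • (B' * A') := conj_zetaCommute g hAB
    have hBs : B' = fromBlocks B'.toBlocks₁₁ B'.toBlocks₁₂ B'.toBlocks₂₁ B'.toBlocks₂₂ :=
      (fromBlocks_toBlocks B').symm
    rw [hBs, hAb, fromBlocks_multiply, fromBlocks_multiply, fromBlocks_smul, fromBlocks_inj] at hAB'
    simp only [Matrix.zero_mul, Matrix.mul_zero, add_zero, zero_add] at hAB'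
    obtain ⟨e11, e12, e21, e22⟩ := hAB'
    -- The off-diagonal blocks of `B'` solve Sylvester equations between an invertible and a
    -- nilpotent matrix; one of the two needs `ζ ≠ 0`.
    have hB12 : B'.toBlocks₁₂ = 0 := by
      refine eq_zero_of_mul_isNilpotent_eq_isUnit_mul hX (hY.smul ζ) ?_
      rw [Matrix.mul_smul, e12]
    have hζX : IsUnit (ζ • A'.toBlocks₁₁) := hX.smul (Units.mk0 ζ hζ)
    have hB21 : B'.toBlocks₂₁ = 0 := by
      refine eq_zero_of_isNilpotent_mul_eq_mul_isUnit hζX hY ?_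
      rw [Matrix.mul_smul, e21]
    refine ⟨g, ⟨⟨⟨(A'.toBlocks₁₁, B'.toBlocks₁₁), e11, hX⟩,
      ⟨(A'.toBlocks₂₂, B'.toBlocks₂₂), e22, hY⟩⟩, ?_⟩⟩
    refine Prod.ext hAb.symm ?_
    change fromBlocks B'.toBlocks₁₁ 0 0 B'.toBlocks₂₂ = B'
    conv_rhs => rw [hBs, hB12, hB21]
  · rintro _ ⟨⟨⟨⟨X, Z⟩, hXZ, hX⟩, ⟨⟨Y, W⟩, hYW, hY⟩⟩, rfl⟩ g
    constructor
    · rintro ⟨⟨⟨⟨X', Z'⟩, hXZ', hX'⟩, ⟨⟨Y', W'⟩, hYW', hY'⟩⟩, hg⟩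
      have h1 : fromBlocks X' 0 0 Y' = g.1 * fromBlocks X 0 0 Y * g⁻¹.1 := congrArg Prod.fst hg
      have h2 : fromBlocks X' 0 0 Y' * g.1 = g.1 * fromBlocks X 0 0 Y := by
        rw [h1, Units.inv_mul_cancel_right]
      rw [← fromBlocks_toBlocks g.1, fromBlocks_multiply, fromBlocks_multiply,
        fromBlocks_inj] at h2
      simp only [Matrix.zero_mul, Matrix.mul_zero, add_zero, zero_add] at h2
      have h12 := eq_zero_of_mul_isNilpotent_eq_isUnit_mul hX' hY h2.2.1.symm
      have h21 := eq_zero_of_isNilpotent_mul_eq_mul_isUnit hX hY' h2.2.2.1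
      obtain ⟨k₁, k₂, hk⟩ := exists_blockUpper_eq h21
      rw [h12] at hk
      exact ⟨(k₁, k₂), hk.symm⟩
    · rintro ⟨⟨k₁, k₂⟩, rfl⟩
      refine ⟨⟨⟨(k₁.1 * X * k₁⁻¹.1, k₁.1 * Z * k₁⁻¹.1), conj_zetaCommute k₁ hXZ,
          (k₁.isUnit.mul hX).mul k₁⁻¹.isUnit⟩,
        ⟨(k₂.1 * Y * k₂⁻¹.1, k₂.1 * W * k₂⁻¹.1), conj_zetaCommute k₂ hYW,
          isNilpotent_conj k₂ hY⟩⟩, ?_⟩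
      exact Prod.ext (blockUpper_zero_conj k₁ k₂ X Y).symm (blockUpper_zero_conj k₁ k₂ Z W).symm

theorem card_GL_congr {ι κ : Type*} [Fintype ι] [DecidableEq ι] [Fintype κ] [DecidableEq κ]
    (e : ι ≃ κ) : Nat.card (GL ι F) = Nat.card (GL κ F) :=
  Nat.card_congr (Units.mapEquiv (reindexAlgEquiv F F e).toMulEquiv).toEquiv

/-- Pairs of matrices may be reindexed without changing the number of solutions of
`A B = ζ B A` subject to a further condition on `A`. -/
theorem card_zetaCommute_congr {ι κ : Type*} [Fintype ι] [DecidableEq ι] [Fintype κ]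
    [DecidableEq κ] (e : ι ≃ κ) (ζ : F) {p : Matrix ι ι F → Prop} {p' : Matrix κ κ F → Prop}
    (h : ∀ A, p A ↔ p' (reindexAlgEquiv F F e A)) :
    Nat.card {P : Matrix ι ι F × Matrix ι ι F | P.1 * P.2 = ζ • (P.2 * P.1) ∧ p P.1} =
      Nat.card {P : Matrix κ κ F × Matrix κ κ F | P.1 * P.2 = ζ • (P.2 * P.1) ∧ p' P.1} := by
  let E := reindexAlgEquiv F F e
  refine Nat.card_congr (Equiv.subtypeEquiv (E.toEquiv.prodCongr E.toEquiv) ?_)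
  rintro ⟨A, B⟩
  change A * B = ζ • (B * A) ∧ p A ↔ E A * E B = ζ • (E B * E A) ∧ p' (E A)
  rw [h A, ← map_mul, ← map_mul, ← map_smul, E.injective.eq_iff]

/-- The number of pairs in `K` for which the invertible part of `A` has size `a`. -/
theorem card_fitting {ζ : F} (hζ : ζ ≠ 0) (a b : ℕ) :
    Nat.card (GL (Fin (a + b)) F) * (Nat.card (U ζ a) * Nat.card (N ζ b)) =
      Nat.card {P : Matrix (Fin (a + b)) (Fin (a + b)) F × Matrix (Fin (a + b)) (Fin (a + b)) F |
        P.1 * P.2 = ζ • (P.2 * P.1) ∧ (P.1 ^ (a + b)).rank = a} *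
      (Nat.card (GL (Fin a) F) * Nat.card (GL (Fin b) F)) := by
  rw [← card_GL_congr finSumFinEquiv, card_fitting_slice hζ a b,
    card_zetaCommute_congr finSumFinEquiv ζ (p := fun A => (A ^ (a + b)).rank = a)
      (p' := fun A => (A ^ (a + b)).rank = a) fun A => ?_]
  rw [← map_pow, coe_reindexAlgEquiv, rank_reindex]

theorem card_GL_pos [Fintype F] (n : ℕ) : (0 : ℝ) < Nat.card (GL (Fin n) F) := by
  exact_mod_cast Nat.card_pos

/-- The pairs in `K` are sorted by the size of the invertible part of `A`, that is by the rank of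
`A ^ n`. -/
theorem genFun_K_eq_mul [Fintype F] {ζ : F} (hζ : ζ ≠ 0) :
    genFun (K ζ) = genFun (U ζ) * genFun (N ζ) := by
  ext n
  simp only [genFun, coeff_mul, coeff_mk]
  have hsplit : Nat.card (K ζ n) = ∑ p ∈ Finset.HasAntidiagonal.antidiagonal n,
      Nat.card {P : Matrix (Fin n) (Fin n) F × Matrix (Fin n) (Fin n) F |
        P.1 * P.2 = ζ • (P.2 * P.1) ∧ (P.1 ^ n).rank = p.1} := by
    classical
    rw [Finset.Nat.sum_antidiagonal_eq_sum_range_succ (fun i _ => Nat.card {P :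
      Matrix (Fin n) (Fin n) F × Matrix (Fin n) (Fin n) F |
        P.1 * P.2 = ζ • (P.2 * P.1) ∧ (P.1 ^ n).rank = i})]
    simp only [Nat.card_eq_fintype_card, Fintype.card_subtype, K, Set.coe_ofPred]
    rw [Finset.card_eq_sum_card_fiberwise (f := fun P => (P.1 ^ n).rank)
      (t := Finset.range n.succ)]
    · simp only [Finset.filter_filter]
    · intro P _
      simpa [Nat.lt_succ_iff] using rank_le_width (P.1 ^ n)
  rw [hsplit, Nat.cast_sum, Finset.sum_div]
  refine Finset.sum_congr rfl ?_
  rintro ⟨a, b⟩ hab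
  obtain rfl := Finset.HasAntidiagonal.mem_antidiagonal.1 hab
  have h := congrArg (Nat.cast : ℕ → ℝ) (card_fitting hζ a b)
  push_cast at h
  have h1 := (card_GL_pos (F := F) a).ne'
  have h2 := (card_GL_pos (F := F) b).ne'
  have h3 := (card_GL_pos (F := F) (a + b)).ne'
  rw [div_mul_div_comm, div_eq_div_iff h3 (mul_ne_zero h1 h2)]
  linarith

end Fitting

/-! ### Counting full-rank matrices -/

section FullRank

open Matrix Module

theorem card_fiber_mul_card {A B : Type*} [AddGroup A] [AddGroup B] (f : A →+ B)
    (hf : Function.Surjective f) (y : B) :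
    Nat.card {x // f x = y} * Nat.card B = Nat.card A := by
  obtain ⟨x₀, rfl⟩ := hf y
  have e : {x // f x = f x₀} ≃ f.ker :=
    { toFun := fun x => ⟨x.1 - x₀, by rw [AddMonoidHom.mem_ker, map_sub, x.2, sub_self]⟩
      invFun := fun k => ⟨k.1 + x₀, by rw [map_add, f.mem_ker.1 k.2, zero_add]⟩
      left_inv := fun x => by simp
      right_inv := fun k => by simp }
  rw [Nat.card_congr e,
    ← Nat.card_congr (QuotientAddGroup.quotientKerEquivOfSurjective f hf).toEquiv, mul_comm]
  exact (AddSubgroup.card_eq_card_quotient_mul_card_addSubgroup f.ker).symm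

theorem card_matrix {F : Type*} [Fintype F] (ι κ : Type*) [Fintype ι] [Fintype κ] :
    Nat.card (Matrix ι κ F) = Fintype.card F ^ (Fintype.card ι * Fintype.card κ) := by
  classical
  rw [Nat.card_eq_fintype_card]
  change Fintype.card (ι → κ → F) = _
  rw [Fintype.card_fun, Fintype.card_fun, ← pow_mul, mul_comm]

variable {F : Type*} [Field F] {ι κ : Type*} [Fintype ι] [Fintype κ]

theorem rank_eq_card_iff_surjective (M : Matrix ι κ F) :
    M.rank = Fintype.card ι ↔ Function.Surjective M.mulVec := by
  have h : Function.Surjective M.mulVec ↔ LinearMap.range M.mulVecLin = ⊤ := by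
    rw [LinearMap.range_eq_top]; rfl
  rw [h, rank, ← finrank_fintype_fun_eq_card F]
  exact ⟨Submodule.eq_top_of_finrank_eq, fun h => by rw [h, finrank_top]⟩

theorem exists_mul_eq_one_of_rank [DecidableEq ι] {M : Matrix ι κ F}
    (h : M.rank = Fintype.card ι) : ∃ R : Matrix κ ι F, M * R = 1 :=
  mulVec_surjective_iff_exists_right_inverse.1 ((rank_eq_card_iff_surjective M).1 h)

theorem card_rank_eq_of_lt {s r : ℕ} (h : r < s) :
    Nat.card {C : Matrix (Fin s) (Fin r) F // C.rank = s} = 0 := by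
  have : IsEmpty {C : Matrix (Fin s) (Fin r) F // C.rank = s} :=
    ⟨fun C => by have := rank_le_width C.1; have := C.2; omega⟩
  exact Nat.card_of_isEmpty

variable [Fintype F]

/-- The number of `s × r` matrices of rank `s`. -/
theorem card_rank_eq {s r : ℕ} (h : s ≤ r) :
    Nat.card {C : Matrix (Fin s) (Fin r) F // C.rank = s} =
      ∏ i : Fin s, (Fintype.card F ^ r - Fintype.card F ^ (i : ℕ)) := by
  have h1 := card_linearIndependent (K := F) (V := Fin r → F) (k := s) (by simpa using h)
  rw [finrank_fintype_fun_eq_card, Fintype.card_fin] at h1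
  rw [← h1]
  refine Nat.card_congr (Equiv.subtypeEquiv (Equiv.refl _) fun C => ?_)
  rw [linearIndependent_iff_card_eq_finrank_span, Fintype.card_fin, rank_eq_finrank_span_row,
    eq_comm]
  rfl

/-- Completing the rows of an `s × r` matrix of rank `s` to an invertible `r × r` matrix. -/
theorem card_GL_eq_card_rank_mul (s t : ℕ) :
    Nat.card (GL (Fin (s + t)) F) = Nat.card {C : Matrix (Fin s) (Fin (s + t)) F // C.rank = s} *
      (Fintype.card F ^ (s * t) * Nat.card (GL (Fin t) F)) := by
  rw [card_GL_field, card_GL_field, card_rank_eq (Nat.le_add_right s t), Fin.prod_univ_add]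
  congr 1
  have h : Fintype.card F ^ (s * t) = ∏ _i : Fin t, Fintype.card F ^ s := by
    rw [Fin.prod_const, pow_mul]
  rw [h, ← Finset.prod_mul_distrib]
  refine Finset.prod_congr rfl fun i _ => ?_
  simp only [Fin.val_natAdd]
  rw [pow_add, pow_add, Nat.mul_sub]

/-- The coefficients of `H(x; q)` are the reciprocals of the proportions of invertible matrices. -/
theorem pow_sq_div_card_GL (t : ℕ) :
    (Fintype.card F : ℝ) ^ (t * t) / Nat.card (GL (Fin t) F) = invQPoch (Fintype.card F) t := by
  rw [card_GL_field, pow_mul', ← Fin.prod_const, Nat.cast_prod, ← Finset.prod_div_distrib,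
    invQPoch, ← Fin.prod_univ_eq_prod_range (fun i => (1 - ((Fintype.card F : ℝ) ^ (i + 1))⁻¹)⁻¹),
    ← Equiv.prod_comp Fin.revPerm]
  refine Finset.prod_congr rfl fun i _ => ?_
  have hq : (1 : ℝ) < Fintype.card F := by exact_mod_cast Fintype.one_lt_card
  have hlt : (Fintype.card F : ℝ) ^ ((Fin.revPerm i : Fin t) : ℕ) < (Fintype.card F : ℝ) ^ t :=
    pow_lt_pow_right₀ hq (Fin.revPerm i).2
  rw [Nat.cast_sub (Nat.pow_le_pow_right Fintype.card_pos (Fin.revPerm i).2.le)]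
  push_cast
  have h0 : (Fintype.card F : ℝ) ^ t ≠ 0 := by positivity
  have h1 : (Fintype.card F : ℝ) ^ t =
      (Fintype.card F : ℝ) ^ ((Fin.revPerm i : Fin t) : ℕ) *
        (Fintype.card F : ℝ) ^ ((i : ℕ) + 1) := by
    rw [← pow_add]
    congr 1
    simp only [Fin.revPerm_apply, Fin.val_rev]
    omega
  have h2 : 1 - ((Fintype.card F : ℝ) ^ ((i : ℕ) + 1))⁻¹ =
      ((Fintype.card F : ℝ) ^ t - (Fintype.card F : ℝ) ^ ((Fin.revPerm i : Fin t) : ℕ)) /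
        (Fintype.card F : ℝ) ^ t := by
    rw [sub_div, div_self h0]
    congr 1
    rw [h1, div_mul_eq_div_div, div_self (by positivity), one_div]
  rw [h2, inv_div]

/-- The number of ways to complete a `w × w` matrix of corank `s` by `r` further columns to a
matrix of rank `w`: the further columns only matter modulo the column space. -/
theorem card_completion_mul {w r s : ℕ} (A : Matrix (Fin w) (Fin w) F) (hs : A.rank + s = w) :
    Nat.card {A₂ : Matrix (Fin w) (Fin r) F // (fromCols A A₂).rank = w} *
        Fintype.card F ^ (s * r) =
      Nat.card {C : Matrix (Fin s) (Fin r) F // C.rank = s} * Fintype.card F ^ (w * r) := by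
  classical
  -- `Q` is the quotient map by the column space of `A`.
  obtain ⟨Q, hQker, hQ⟩ : ∃ Q : Matrix (Fin s) (Fin w) F,
      (∀ v, Q *ᵥ v = 0 ↔ v ∈ LinearMap.range A.mulVecLin) ∧ Function.Surjective Q.mulVec := by
    have hd : finrank F ((Fin w → F) ⧸ LinearMap.range A.mulVecLin) = finrank F (Fin s → F) := by
      have h := Submodule.finrank_quotient_add_finrank (LinearMap.range A.mulVecLin)
      rw [finrank_fintype_fun_eq_card, Fintype.card_fin] at h ⊢
      rw [rank] at hs
      omega
    let e := LinearEquiv.ofFinrankEq _ _ hd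
    refine ⟨LinearMap.toMatrix' (e.toLinearMap ∘ₗ (LinearMap.range A.mulVecLin).mkQ),
      fun v => ?_, fun y => ?_⟩
    · rw [LinearMap.toMatrix'_mulVec]
      simp [-LinearMap.mem_range]
    · obtain ⟨x, hx⟩ := e.surjective y
      obtain ⟨x, rfl⟩ := Submodule.mkQ_surjective _ x
      exact ⟨x, by rw [LinearMap.toMatrix'_mulVec]; exact hx⟩
  obtain ⟨R, hR⟩ := mulVec_surjective_iff_exists_right_inverse.1 hQ
  have hiff : ∀ A₂ : Matrix (Fin w) (Fin r) F,
      (fromCols A A₂).rank = w ↔ (Q * A₂).rank = s := by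
    intro A₂
    have h1 := rank_eq_card_iff_surjective (fromCols A A₂)
    have h2 := rank_eq_card_iff_surjective (Q * A₂)
    rw [Fintype.card_fin] at h1 h2
    rw [h1, h2]
    constructor
    · intro h y
      obtain ⟨x, rfl⟩ := hQ y
      obtain ⟨u, rfl⟩ := h x
      refine ⟨u ∘ Sum.inr, ?_⟩
      change (Q * A₂) *ᵥ _ = Q *ᵥ (fromCols A A₂ *ᵥ u)
      rw [fromCols_mulVec, mulVec_add, (hQker (A *ᵥ (u ∘ Sum.inl))).2 ⟨u ∘ Sum.inl, rfl⟩,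
        zero_add, mulVec_mulVec]
    · intro h x
      obtain ⟨v, hv⟩ := h (Q *ᵥ x)
      have h3 : Q *ᵥ (x - A₂ *ᵥ v) = 0 := by
        rw [mulVec_sub, mulVec_mulVec]
        exact sub_eq_zero.2 hv.symm
      obtain ⟨u, hu⟩ := (hQker _).1 h3
      refine ⟨Sum.elim u v, ?_⟩
      change fromCols A A₂ *ᵥ _ = x
      rw [fromCols_mulVec, Sum.elim_comp_inl, Sum.elim_comp_inr, ← mulVecLin_apply A, hu,
        sub_add_cancel]
  have hfib : ∀ C : Matrix (Fin s) (Fin r) F,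
      Nat.card {A₂ : Matrix (Fin w) (Fin r) F // Q * A₂ = C} * Fintype.card F ^ (s * r) =
        Fintype.card F ^ (w * r) := by
    intro C
    have h := card_fiber_mul_card (AddMonoidHom.mk' (fun A₂ : Matrix (Fin w) (Fin r) F => Q * A₂)
      fun _ _ => Matrix.mul_add _ _ _) (fun C => ⟨R * C, by simp [← Matrix.mul_assoc, hR]⟩) C
    simp only [card_matrix, Fintype.card_fin] at h
    exact h
  let e : {A₂ : Matrix (Fin w) (Fin r) F // (fromCols A A₂).rank = w} ≃
      Σ C : {C : Matrix (Fin s) (Fin r) F // C.rank = s},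
        {A₂ : Matrix (Fin w) (Fin r) F // Q * A₂ = C.1} :=
    { toFun := fun A₂ => ⟨⟨Q * A₂.1, (hiff _).1 A₂.2⟩, ⟨A₂.1, rfl⟩⟩
      invFun := fun x => ⟨x.2.1, (hiff _).2 (by rw [x.2.2]; exact x.1.2)⟩
      left_inv := fun _ => rfl
      right_inv := by
        rintro ⟨⟨C, hC⟩, ⟨A₂, hA⟩⟩
        obtain rfl : Q * A₂ = C := hA
        rfl }
  rw [Nat.card_congr e, Nat.card_sigma, Finset.sum_mul, Finset.sum_congr rfl fun C _ => hfib C.1,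
    Finset.sum_const, smul_eq_mul, Finset.card_univ, Nat.card_eq_fintype_card]

/-- The number of solutions of a linear system whose coefficient matrix has full row rank. -/
theorem card_solutions_mul {w r k : ℕ} {M : Matrix (Fin w) (Fin w ⊕ Fin r) F} (hM : M.rank = w)
    (C : Matrix (Fin w) (Fin k) F) :
    Nat.card {Z : Matrix (Fin w ⊕ Fin r) (Fin k) F // M * Z = C} = Fintype.card F ^ (r * k) := by
  obtain ⟨R, hR⟩ := exists_mul_eq_one_of_rank (M := M) (by simpa using hM)
  have h := card_fiber_mul_card (AddMonoidHom.mk'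
    (fun Z : Matrix (Fin w ⊕ Fin r) (Fin k) F => M * Z)
      fun _ _ => Matrix.mul_add _ _ _) (fun C => ⟨R * C, by simp [← Matrix.mul_assoc, hR]⟩) C
  simp only [card_matrix, Fintype.card_fin, Fintype.card_sum, AddMonoidHom.mk'_apply] at h
  rw [add_mul, pow_add, mul_comm (_ ^ (w * k))] at h
  exact Nat.eq_of_mul_eq_mul_right (pow_pos Fintype.card_pos _) h

end FullRank

/-! ### The corank recursion for pairs with nilpotent first entry -/

section Corank

open Matrix Module

variable {F : Type*} [Field F]

theorem fromBlocks_zero_zero_pow_succ {ι κ : Type*} [Fintype ι] [DecidableEq ι] [Fintype κ]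
    [DecidableEq κ] (A₁ : Matrix ι ι F) (A₂ : Matrix ι κ F) (k : ℕ) :
    (fromBlocks A₁ A₂ 0 0 : Matrix (ι ⊕ κ) (ι ⊕ κ) F) ^ (k + 1) =
      fromBlocks (A₁ ^ (k + 1)) (A₁ ^ k * A₂) 0 0 := by
  induction k with
  | zero => simp
  | succ k ih =>
    rw [pow_succ, ih, fromBlocks_multiply]
    simp [← pow_succ]

theorem isNilpotent_fromBlocks_zero_zero {ι κ : Type*} [Fintype ι] [DecidableEq ι] [Fintype κ]
    [DecidableEq κ] {A₁ : Matrix ι ι F} {A₂ : Matrix ι κ F} :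
    IsNilpotent (fromBlocks A₁ A₂ 0 0 : Matrix (ι ⊕ κ) (ι ⊕ κ) F) ↔ IsNilpotent A₁ := by
  constructor
  · rintro ⟨k, hk⟩
    have h := fromBlocks_zero_zero_pow_succ A₁ A₂ k
    rw [pow_succ, hk, zero_mul, ← fromBlocks_zero, fromBlocks_inj] at h
    exact ⟨k + 1, h.1.symm⟩
  · rintro ⟨k, hk⟩
    refine ⟨k + 1, ?_⟩
    rw [fromBlocks_zero_zero_pow_succ, pow_succ, hk]
    simp

theorem rank_fromBlocks_zero_zero {ι κ : Type*} [Fintype ι] [DecidableEq ι] [Fintype κ]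
    [DecidableEq κ] (A₁ : Matrix ι ι F) (A₂ : Matrix ι κ F) :
    (fromBlocks A₁ A₂ 0 0 : Matrix (ι ⊕ κ) (ι ⊕ κ) F).rank = (fromCols A₁ A₂).rank := by
  have h1 : (fromBlocks A₁ A₂ 0 0 : Matrix (ι ⊕ κ) (ι ⊕ κ) F) =
      fromRows (1 : Matrix ι ι F) (0 : Matrix κ ι F) * fromCols A₁ A₂ := by
    rw [fromRows_mul_fromCols]
    simp
  have h2 : fromCols A₁ A₂ = fromCols (1 : Matrix ι ι F) (0 : Matrix ι κ F) *
      (fromBlocks A₁ A₂ 0 0 : Matrix (ι ⊕ κ) (ι ⊕ κ) F) := by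
    rw [fromCols_mul_fromBlocks]
    simp
  refine le_antisymm ?_ ?_
  · rw [h1]
    exact rank_mul_le_right _ _
  · conv_lhs => rw [h2]
    exact rank_mul_le_right _ _

/-- The data of a pair `(A, B)` with `A` nilpotent, `A B = ζ B A` and column space of `A` equal to
the span of the first `w` coordinates: the induced pair on that span, the remaining columns of `A`
and the remaining columns of `B`. -/
abbrev ExtensionData (ζ : F) (w r : ℕ) : Type _ :=
  Σ x : N ζ w, Σ A₂ : {A₂ : Matrix (Fin w) (Fin r) F // (fromCols x.1.1 A₂).rank = w},
    {Z : Matrix (Fin w ⊕ Fin r) (Fin r) F // fromCols x.1.1 A₂.1 * Z = ζ • (x.1.2 * A₂.1)}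

/-- The pair of matrices described by `ExtensionData`. -/
def ExtensionData.pair {ζ : F} {w r : ℕ} (d : ExtensionData ζ w r) :
    Matrix (Fin w ⊕ Fin r) (Fin w ⊕ Fin r) F × Matrix (Fin w ⊕ Fin r) (Fin w ⊕ Fin r) F :=
  (fromBlocks d.1.1.1 d.2.1.1 0 0,
    fromBlocks d.1.1.2 d.2.2.1.toRows₁ 0 d.2.2.1.toRows₂)

theorem ExtensionData.pair_injective {ζ : F} {w r : ℕ} :
    Function.Injective (ExtensionData.pair : ExtensionData ζ w r → _) := by
  rintro ⟨⟨⟨A, B⟩, h⟩, ⟨A₂, h₂⟩, ⟨Z, hZ⟩⟩ ⟨⟨⟨A', B'⟩, h'⟩, ⟨A₂', h₂'⟩, ⟨Z', hZ'⟩⟩ e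
  simp only [ExtensionData.pair, Prod.mk.injEq, fromBlocks_inj] at e
  obtain ⟨⟨rfl, rfl, -⟩, rfl, e1, -, e2⟩ := e
  obtain rfl : Z = Z' := by rw [← fromRows_toRows Z, ← fromRows_toRows Z', e1, e2]
  rfl

/-- If `A` has column space the span of the first `w` coordinates, then `A B = ζ B A` forces `B` to
preserve that span, so that `(A, B)` comes from `ExtensionData`. -/
theorem ExtensionData.mem_range_pair {ζ : F} (hζ : ζ ≠ 0) {w r : ℕ}
    {P : Matrix (Fin w ⊕ Fin r) (Fin w ⊕ Fin r) F × Matrix (Fin w ⊕ Fin r) (Fin w ⊕ Fin r) F} :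
    P ∈ Set.range (ExtensionData.pair (ζ := ζ)) ↔
      (P.1 * P.2 = ζ • (P.2 * P.1) ∧ IsNilpotent P.1 ∧ P.1.rank = w) ∧
        P.1.toBlocks₂₁ = 0 ∧ P.1.toBlocks₂₂ = 0 := by
  constructor
  · rintro ⟨⟨⟨⟨A, B⟩, hAB, hA⟩, ⟨A₂, h₂⟩, ⟨Z, hZ⟩⟩, rfl⟩
    refine ⟨⟨?_, isNilpotent_fromBlocks_zero_zero.2 hA, ?_⟩, rfl, rfl⟩
    · simp only [ExtensionData.pair] at hAB hZ ⊢
      rw [← fromRows_toRows Z, fromCols_mul_fromRows] at hZ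
      rw [fromBlocks_multiply, fromBlocks_multiply, fromBlocks_smul]
      simp [hAB, hZ]
    · simp only [ExtensionData.pair]
      rw [rank_fromBlocks_zero_zero]
      exact h₂
  · rintro ⟨⟨hAB, hA, hr⟩, h21, h22⟩
    obtain ⟨A, B⟩ := P
    dsimp only at hAB hA hr h21 h22
    have hAs : A = fromBlocks A.toBlocks₁₁ A.toBlocks₁₂ 0 0 := by
      conv_lhs => rw [← fromBlocks_toBlocks A, h21, h22]
    have hBs := (fromBlocks_toBlocks B).symm
    rw [hAs, isNilpotent_fromBlocks_zero_zero] at hA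
    rw [hAs, rank_fromBlocks_zero_zero] at hr
    rw [hAs, hBs, fromBlocks_multiply, fromBlocks_multiply, fromBlocks_smul, fromBlocks_inj] at hAB
    simp only [Matrix.zero_mul, Matrix.mul_zero, add_zero] at hAB
    obtain ⟨e11, e12, e21, e22⟩ := hAB
    have hB21 : B.toBlocks₂₁ = 0 := by
      obtain ⟨R, hR⟩ := exists_mul_eq_one_of_rank (M := fromCols A.toBlocks₁₁ A.toBlocks₁₂)
        (by simpa using hr)
      have h : B.toBlocks₂₁ * fromCols A.toBlocks₁₁ A.toBlocks₁₂ = 0 := by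
        rw [mul_fromCols, (smul_eq_zero_iff_right hζ).1 e21.symm,
          (smul_eq_zero_iff_right hζ).1 e22.symm, fromCols_zero]
      rw [← Matrix.mul_one B.toBlocks₂₁, ← hR, ← Matrix.mul_assoc, h, Matrix.zero_mul]
    rw [hB21, Matrix.mul_zero, add_zero] at e11
    refine ⟨⟨⟨(A.toBlocks₁₁, B.toBlocks₁₁), e11, hA⟩, ⟨A.toBlocks₁₂, hr⟩,
      ⟨fromRows B.toBlocks₁₂ B.toBlocks₂₂, by rw [fromCols_mul_fromRows, e12]⟩⟩, ?_⟩
    refine Prod.ext hAs.symm ?_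
    simp only [ExtensionData.pair, toRows₁_fromRows, toRows₂_fromRows]
    conv_rhs => rw [hBs, hB21]

/-- Every pair with `A` of rank `w` can be conjugated so that the column space of `A` is the span of
the first `w` coordinates, uniquely up to block upper triangular matrices. -/
theorem card_corank_slice {ζ : F} (hζ : ζ ≠ 0) (w r : ℕ) :
    Nat.card (GL (Fin w ⊕ Fin r) F) * Nat.card (ExtensionData ζ w r) =
      Nat.card {P : Matrix (Fin w ⊕ Fin r) (Fin w ⊕ Fin r) F ×
          Matrix (Fin w ⊕ Fin r) (Fin w ⊕ Fin r) F |
        P.1 * P.2 = ζ • (P.2 * P.1) ∧ IsNilpotent P.1 ∧ P.1.rank = w} *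
      (Nat.card (GL (Fin w) F) *
        (Nat.card (GL (Fin r) F) * Nat.card (Matrix (Fin w) (Fin r) F))) := by
  have key := card_mul_card_slice (conjPair (F := F) (ι := Fin w ⊕ Fin r))
    (S := {P | P.1 * P.2 = ζ • (P.2 * P.1) ∧ IsNilpotent P.1 ∧ P.1.rank = w})
    (S₀ := Set.range (ExtensionData.pair (ζ := ζ) (w := w) (r := r)))
    (P := Set.range (blockUpper (F := F) (ι := Fin w) (κ := Fin r))) ?_ ?_ ?_ ?_
  · rwa [Nat.card_range_of_injective ExtensionData.pair_injective,
      Nat.card_range_of_injective blockUpper_injective, Nat.card_prod, Nat.card_prod] at key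
  · rintro g P ⟨h1, h2, h3⟩
    exact ⟨conj_zetaCommute g h1, isNilpotent_conj g h2, by rw [conjPair_fst, rank_conj, h3]⟩
  · intro P hP
    exact ((ExtensionData.mem_range_pair hζ).1 hP).1
  · rintro ⟨A, B⟩ ⟨hAB, hA, hr⟩
    obtain ⟨W, hW⟩ := exists_isCompl (LinearMap.range A.mulVecLin)
    obtain ⟨g, hg, -⟩ := exists_GL_of_isCompl hW hr
    have hz : ∀ v j, ((g.1 * A * g⁻¹.1) *ᵥ v) (Sum.inr j) = 0 := by
      intro v j
      have h := (hg (A *ᵥ (g⁻¹.1 *ᵥ v))).1 ⟨_, rfl⟩ j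
      rwa [mulVec_mulVec, mulVec_mulVec] at h
    refine ⟨g, (ExtensionData.mem_range_pair hζ).2 ⟨⟨conj_zetaCommute g hAB, isNilpotent_conj g hA,
      by rw [conjPair_fst, rank_conj]; exact hr⟩, ?_, ?_⟩⟩
    · ext j i
      simpa [toBlocks₂₁] using hz (Pi.single (Sum.inl i) 1) j
    · ext j i
      simpa [toBlocks₂₂] using hz (Pi.single (Sum.inr i) 1) j
  · rintro P hP g
    have hP' := (ExtensionData.mem_range_pair hζ).1 hP
    obtain ⟨⟨h1, h2, h3⟩, h21, h22⟩ := hP'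
    have hAs : P.1 = fromBlocks P.1.toBlocks₁₁ P.1.toBlocks₁₂ 0 0 := by
      conv_lhs => rw [← fromBlocks_toBlocks P.1, h21, h22]
    constructor
    · intro hgP
      obtain ⟨-, h21', h22'⟩ := (ExtensionData.mem_range_pair hζ).1 hgP
      set A' := (conjPair g P).1 with hA'
      have hAs' : A' = fromBlocks A'.toBlocks₁₁ A'.toBlocks₁₂ 0 0 := by
        conv_lhs => rw [← fromBlocks_toBlocks A', h21', h22']
      have h : A' * g.1 = g.1 * P.1 := by
        rw [hA', conjPair_fst, Units.inv_mul_cancel_right]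
      rw [hAs', hAs, ← fromBlocks_toBlocks g.1, fromBlocks_multiply, fromBlocks_multiply,
        fromBlocks_inj] at h
      simp only [Matrix.zero_mul, Matrix.mul_zero, add_zero] at h
      obtain ⟨-, -, e21, e22⟩ := h
      rw [hAs, rank_fromBlocks_zero_zero] at h3
      obtain ⟨R, hR⟩ := exists_mul_eq_one_of_rank
        (M := fromCols P.1.toBlocks₁₁ P.1.toBlocks₁₂) (by simpa using h3)
      have h21g : g.1.toBlocks₂₁ = 0 := by
        have h : g.1.toBlocks₂₁ * fromCols P.1.toBlocks₁₁ P.1.toBlocks₁₂ = 0 := by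
          rw [mul_fromCols, ← e21, ← e22, fromCols_zero]
        rw [← Matrix.mul_one g.1.toBlocks₂₁, ← hR, ← Matrix.mul_assoc, h, Matrix.zero_mul]
      obtain ⟨k₁, k₂, hk⟩ := exists_blockUpper_eq h21g
      exact ⟨_, hk.symm⟩
    · rintro ⟨x, rfl⟩
      refine (ExtensionData.mem_range_pair hζ).2 ⟨⟨conj_zetaCommute _ h1, isNilpotent_conj _ h2,
        by rw [conjPair_fst, rank_conj, h3]⟩, ?_⟩
      rw [conjPair_fst, hAs, blockUpper_val, ← fromBlocks_toBlocks (blockUpper x)⁻¹.1,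
        fromBlocks_multiply, fromBlocks_multiply]
      simp

/-- The number of pairs `(A, B)` of `n × n` matrices with `A B = ζ B A` and `A` nilpotent of
corank `r`. -/
noncomputable def cardCorank (ζ : F) (n r : ℕ) : ℕ :=
  Nat.card {P : Matrix (Fin n) (Fin n) F × Matrix (Fin n) (Fin n) F |
    P.1 * P.2 = ζ • (P.2 * P.1) ∧ IsNilpotent P.1 ∧ P.1.rank + r = n}

theorem cardCorank_of_lt (ζ : F) {n r : ℕ} (h : n < r) : cardCorank ζ n r = 0 := by
  have : IsEmpty {P : Matrix (Fin n) (Fin n) F × Matrix (Fin n) (Fin n) F |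
      P.1 * P.2 = ζ • (P.2 * P.1) ∧ IsNilpotent P.1 ∧ P.1.rank + r = n} :=
    ⟨fun P => by have := P.2.2.2; omega⟩
  exact Nat.card_of_isEmpty

theorem card_GL_mul_card_extensionData {ζ : F} (hζ : ζ ≠ 0) (w r : ℕ) :
    Nat.card (GL (Fin (w + r)) F) * Nat.card (ExtensionData ζ w r) =
      cardCorank ζ (w + r) r * (Nat.card (GL (Fin w) F) *
        (Nat.card (GL (Fin r) F) * Nat.card (Matrix (Fin w) (Fin r) F))) := by
  rw [← card_GL_congr finSumFinEquiv, card_corank_slice hζ w r, cardCorank,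
    card_zetaCommute_congr finSumFinEquiv ζ (p := fun A => IsNilpotent A ∧ A.rank = w)
      (p' := fun A => IsNilpotent A ∧ A.rank + r = w + r) fun A => ?_]
  rw [IsNilpotent.map_iff (reindexAlgEquiv F F finSumFinEquiv).injective, add_left_inj,
    coe_reindexAlgEquiv, rank_reindex]

theorem sum_N_eq_sum_cardCorank {ζ : F} (n : ℕ) (f : ℕ → ℝ) [Fintype (N ζ n)] :
    ∑ x : N ζ n, f (n - x.1.1.rank) =
      ∑ s ∈ Finset.range (n + 1), (cardCorank ζ n s : ℝ) * f s := by
  classical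
  rw [← Finset.sum_fiberwise_of_maps_to (s := Finset.univ) (t := Finset.range (n + 1))
    (g := fun x : N ζ n => n - x.1.1.rank) (by intro x _; simp)]
  refine Finset.sum_congr rfl fun s hs => ?_
  rw [Finset.sum_congr rfl (g := fun _ => f s) (by
    intro x hx; rw [(Finset.mem_filter.1 hx).2]), Finset.sum_const, nsmul_eq_mul]
  congr 2
  rw [← Fintype.card_subtype, cardCorank, ← Nat.card_eq_fintype_card]
  refine Nat.card_congr ?_
  refine (Equiv.subtypeSubtypeEquivSubtypeInter (fun P => P ∈ N ζ n)
    (fun P => n - P.1.rank = s)).trans (Equiv.subtypeEquivRight fun P => ?_)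
  have h1 := rank_le_width P.1
  have h2 := Finset.mem_range.1 hs
  simp only [N, Set.mem_ofPred_eq, and_assoc]
  refine and_congr_right fun _ => and_congr_right fun _ => ?_
  omega

variable [Fintype F]

/-- Over a pair `(A, B)` of size `w` with `A` of corank `s`, the count of the further columns of `A`
depends only on `s`, and the further columns of `B` solve a linear system of full row rank. The
right-hand side does not involve `ζ` except through `cardCorank`. -/
theorem card_extensionData {ζ : F} (w r : ℕ) :
    (Nat.card (ExtensionData ζ w r) : ℝ) =
      ∑ s ∈ Finset.range (w + 1), (cardCorank ζ w s : ℝ) *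
        (Nat.card {C : Matrix (Fin s) (Fin r) F // C.rank = s} *
          (Fintype.card F : ℝ) ^ (w * r) / (Fintype.card F : ℝ) ^ (s * r) *
          (Fintype.card F : ℝ) ^ (r * r)) := by
  classical
  have := Fintype.ofFinite (N ζ w)
  rw [← sum_N_eq_sum_cardCorank w (fun s => Nat.card {C : Matrix (Fin s) (Fin r) F // C.rank = s} *
          (Fintype.card F : ℝ) ^ (w * r) / (Fintype.card F : ℝ) ^ (s * r) *
          (Fintype.card F : ℝ) ^ (r * r)), Nat.card_sigma, Nat.cast_sum]
  refine Finset.sum_congr rfl fun x _ => ?_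
  rw [Nat.card_sigma, Finset.sum_congr rfl fun A₂ _ => card_solutions_mul A₂.2 _, Finset.sum_const,
    Finset.card_univ, smul_eq_mul, ← Nat.card_eq_fintype_card]
  have hq : (Fintype.card F : ℝ) ≠ 0 := by exact_mod_cast Fintype.card_ne_zero
  have h := congrArg (Nat.cast : ℕ → ℝ) (card_completion_mul (r := r) x.1.1
    (Nat.add_sub_cancel' (rank_le_width x.1.1)))
  push_cast at h ⊢
  rw [← h, mul_div_cancel_right₀ _ (pow_ne_zero _ hq)]

/-- The coefficients for corank `r` and size `w + r` in terms of those for size `w`: the powers of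
`q` and the number of `s × r` matrices of rank `s` combine to a coefficient of `H(x; q)`. -/
theorem cardCorank_recursion {ζ : F} (hζ : ζ ≠ 0) (w r : ℕ) :
    (cardCorank ζ (w + r) r : ℝ) / Nat.card (GL (Fin (w + r)) F) =
      ∑ p ∈ Finset.HasAntidiagonal.antidiagonal r,
        (cardCorank ζ w p.1 : ℝ) / Nat.card (GL (Fin w) F) * invQPoch (Fintype.card F) p.2 := by
  have hq : (Fintype.card F : ℝ) ≠ 0 := by exact_mod_cast Fintype.card_ne_zero
  have h1 := (card_GL_pos (F := F) w).ne'
  have h2 := (card_GL_pos (F := F) r).ne'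
  have h3 := (card_GL_pos (F := F) (w + r)).ne'
  have h := congrArg (Nat.cast : ℕ → ℝ) (card_GL_mul_card_extensionData hζ w r)
  rw [card_matrix, Fintype.card_fin, Fintype.card_fin] at h
  push_cast at h
  rw [card_extensionData] at h
  set T : ℕ → ℝ := fun s => (cardCorank ζ w s : ℝ) / Nat.card (GL (Fin w) F) *
    (Nat.card {C : Matrix (Fin s) (Fin r) F // C.rank = s} / Nat.card (GL (Fin r) F) /
      (Fintype.card F : ℝ) ^ (s * r) * (Fintype.card F : ℝ) ^ (r * r)) with hT
  have hL : (cardCorank ζ (w + r) r : ℝ) / Nat.card (GL (Fin (w + r)) F) =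
      ∑ s ∈ Finset.range (w + 1), T s := by
    rw [div_eq_iff h3]
    have hd : (Nat.card (GL (Fin w) F) : ℝ) * (Nat.card (GL (Fin r) F) *
        (Fintype.card F : ℝ) ^ (w * r)) ≠ 0 :=
      mul_ne_zero h1 (mul_ne_zero h2 (pow_ne_zero _ hq))
    rw [← mul_left_inj' hd, ← h, mul_comm (∑ s ∈ _, T s), mul_assoc, Finset.sum_mul]
    congr 1
    refine Finset.sum_congr rfl fun s _ => ?_
    rw [hT]
    field_simp
  have hT0 : ∀ s, r < s → T s = 0 := fun s hs => by
    rw [hT]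
    dsimp only
    rw [card_rank_eq_of_lt hs]
    simp
  have hT1 : ∀ s, w < s → T s = 0 := fun s hs => by
    simp [hT, cardCorank_of_lt ζ hs]
  have hsum : ∑ s ∈ Finset.range (w + 1), T s = ∑ s ∈ Finset.range (r + 1), T s := by
    rcases le_total w r with hwr | hwr
    · exact Finset.sum_subset (Finset.range_subset_range.2 (by omega)) fun s _ hs =>
        hT1 s (by rw [Finset.mem_range] at hs; omega)
    · exact (Finset.sum_subset (Finset.range_subset_range.2 (by omega)) fun s _ hs =>
        hT0 s (by rw [Finset.mem_range] at hs; omega)).symm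
  rw [hL, hsum, Finset.Nat.sum_antidiagonal_eq_sum_range_succ (fun i j =>
    (cardCorank ζ w i : ℝ) / Nat.card (GL (Fin w) F) * invQPoch (Fintype.card F) j)]
  refine Finset.sum_congr rfl fun s hs => ?_
  obtain ⟨t, rfl⟩ := Nat.exists_eq_add_of_le (Nat.lt_succ_iff.1 (Finset.mem_range.1 hs))
  rw [hT, Nat.add_sub_cancel_left, ← pow_sq_div_card_GL]
  dsimp only
  congr 1
  have h4 := congrArg (Nat.cast : ℕ → ℝ) (card_GL_eq_card_rank_mul (F := F) s t)
  push_cast at h4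
  have h5 := (card_GL_pos (F := F) t).ne'
  have h6 : (Nat.card {C : Matrix (Fin s) (Fin (s + t)) F // C.rank = s} : ℝ) ≠ 0 := by
    intro h0
    rw [h0, zero_mul] at h4
    exact h2 h4
  rw [h4]
  field_simp
  ring

end Corank

/-! ### The generating function of the nilpotent part -/

section Nilpotent

open Matrix

variable {F : Type*} [Field F]

theorem cardCorank_zero_zero (ζ : F) : cardCorank ζ 0 0 = 1 := by
  rw [cardCorank, Nat.card_eq_one_iff_unique]
  exact ⟨inferInstance, ⟨0, Subsingleton.elim _ _, ⟨1, Subsingleton.elim _ _⟩, by simp [rank_zero]⟩⟩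

theorem cardCorank_zero_right (ζ : F) {n : ℕ} (hn : n ≠ 0) : cardCorank ζ n 0 = 0 := by
  have : IsEmpty {P : Matrix (Fin n) (Fin n) F × Matrix (Fin n) (Fin n) F |
      P.1 * P.2 = ζ • (P.2 * P.1) ∧ IsNilpotent P.1 ∧ P.1.rank + 0 = n} := by
    refine ⟨fun P => ?_⟩
    obtain ⟨-, hA, hr⟩ := P.2
    have : Nonempty (Fin n) := ⟨⟨0, Nat.pos_of_ne_zero hn⟩⟩
    obtain ⟨R, hR⟩ := exists_mul_eq_one_of_rank (M := P.1.1) (by simpa using hr)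
    exact (hA.not_isUnit) (IsUnit.of_mul_eq_one R hR)
  exact Nat.card_of_isEmpty

variable [Fintype F]

theorem genFun_N_eq_mk (ζ : F) : genFun (N ζ) = PowerSeries.mk fun n =>
    ∑ r ∈ Finset.range (n + 1), (cardCorank ζ n r : ℝ) / Nat.card (GL (Fin n) F) := by
  classical
  ext n
  have := Fintype.ofFinite (N ζ n)
  have h := sum_N_eq_sum_cardCorank (ζ := ζ) n fun _ => 1
  simp only [Finset.sum_const, nsmul_eq_mul, mul_one, Finset.card_univ] at h
  rw [genFun, coeff_mk, coeff_mk, ← Finset.sum_div, ← h, Nat.card_eq_fintype_card]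

theorem hasProd_expand_H {ζ : F} (hζ : ζ ≠ 0) :
    HasProd (fun i : ℕ => PowerSeries.expand (i + 1) i.succ_ne_zero (H (Fintype.card F)))
      (genFun (N ζ)) := by
  rw [genFun_N_eq_mk]
  refine hasProd_expand_H_of_recursion Fintype.one_lt_card ?_ (fun n hn => ?_) (fun n r h => ?_)
    (cardCorank_recursion hζ)
  · simp [cardCorank_zero_zero]
  · simp [cardCorank_zero_right ζ hn]
  · simp [cardCorank_of_lt ζ h]

/-- The product that equals `genFun (N ζ)` does not involve `ζ`. -/
theorem card_N_eq_card_N {ζ ξ : F} (hζ : ζ ≠ 0) (hξ : ξ ≠ 0) (n : ℕ) :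
    Nat.card (N ζ n) = Nat.card (N ξ n) := by
  have h := congrArg (coeff n) ((hasProd_expand_H hζ).unique (hasProd_expand_H hξ))
  rw [genFun, genFun, coeff_mk, coeff_mk, div_left_inj' (card_GL_pos n).ne'] at h
  exact_mod_cast h

end Nilpotent

/-! ### Elementary divisors of a matrix -/

section ElementaryDivisors

open Polynomial Module

/-- The kernel and the cokernel of multiplication by `f` on `R ⧸ (g)` are equinumerous. -/
theorem card_ker_smul_quotient {R : Type*} [CommRing R] (f g : R) [Finite (R ⧸ Ideal.span {g})] :
    Nat.card {x : R ⧸ Ideal.span {g} // f • x = 0} =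
      Nat.card (R ⧸ Ideal.span {g} ⊔ Ideal.span {f}) := by
  set M := R ⧸ Ideal.span {g}
  set φ : M →ₗ[R] M := LinearMap.lsmul R M f with hφ
  have h1 := Submodule.card_eq_card_quotient_mul_card (LinearMap.ker φ)
  have h2 := Submodule.card_eq_card_quotient_mul_card (LinearMap.range φ)
  rw [Nat.card_congr φ.quotKerEquivRange.toEquiv] at h1
  have h3 : Nat.card (LinearMap.ker φ) = Nat.card (M ⧸ LinearMap.range φ) := by
    rw [h1, mul_comm] at h2
    exact Nat.eq_of_mul_eq_mul_left Nat.card_pos h2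
  have h4 : (LinearMap.range φ).toAddSubgroup =
      (Submodule.toAddSubgroup ((Ideal.span {f}).map (Ideal.Quotient.mk (Ideal.span {g})))) := by
    ext x
    rw [Ideal.map_span, Set.image_singleton]
    simp only [Submodule.mem_toAddSubgroup, Ideal.mem_span_singleton', LinearMap.mem_range]
    constructor
    · rintro ⟨y, rfl⟩
      exact ⟨y, by rw [mul_comm]; rfl⟩
    · rintro ⟨y, rfl⟩
      exact ⟨y, by rw [mul_comm]; rfl⟩
  have h5 : Nat.card (M ⧸ LinearMap.range φ) =
      Nat.card (M ⧸ (Ideal.span {f}).map (Ideal.Quotient.mk (Ideal.span {g}))) :=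
    Nat.card_congr (QuotientAddGroup.quotientAddEquivOfEq h4).toEquiv
  rw [← Nat.card_congr (DoubleQuot.quotQuotEquivQuotSup (Ideal.span {g}) (Ideal.span {f})).toEquiv,
    ← h5, ← h3]
  rfl

variable {F : Type*} [Field F]

theorem card_quotient_span [Finite F] {g : F[X]} (hg : g.Monic) :
    Nat.card (F[X] ⧸ Ideal.span {g}) = Nat.card F ^ g.natDegree := by
  have := hg.finite_quotient
  rw [Module.natCard_eq_pow_finrank (K := F), finrank_quotient_span_eq_natDegree]

theorem finite_quotient_span [Finite F] {g : F[X]} (hg : g.Monic) :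
    Finite (F[X] ⧸ Ideal.span {g}) := by
  have := hg.finite_quotient
  exact Module.finite_of_finite F

open Classical in
theorem card_ker_pow_smul_quotient [Finite F] {p π : F[X]} (hp : Irreducible p) (hpm : p.Monic)
    (hπ : Irreducible π) (e k : ℕ) :
    Nat.card {x : F[X] ⧸ Ideal.span {p ^ e} // π ^ k • x = 0} =
      Nat.card F ^ (π.natDegree * if Associated π p then min e k else 0) := by
  have := finite_quotient_span (hpm.pow e)
  rw [card_ker_smul_quotient]
  split_ifs with h
  · have h1 : Ideal.span {p ^ e} ⊔ Ideal.span {π ^ k} = Ideal.span {p ^ min e k} := by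
      rw [Ideal.span_singleton_eq_span_singleton.2 (h.pow_pow (n := k))]
      rcases le_total e k with hek | hek
      · rw [min_eq_left hek, sup_eq_left, Ideal.span_singleton_le_span_singleton]
        exact pow_dvd_pow p hek
      · rw [min_eq_right hek, sup_eq_right, Ideal.span_singleton_le_span_singleton]
        exact pow_dvd_pow p hek
    rw [h1, card_quotient_span (hpm.pow _), natDegree_pow, mul_comm,
      natDegree_eq_of_degree_eq (degree_eq_degree_of_associated h)]
  · have h1 : IsCoprime (p ^ e) (π ^ k) := by
      refine IsCoprime.pow ?_
      rw [hp.coprime_iff_not_dvd]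
      exact fun hd => h (hp.associated_of_dvd hπ hd).symm
    have h2 : Ideal.span {p ^ e} ⊔ Ideal.span {π ^ k} = ⊤ := by
      rw [← Ideal.span_union, Set.singleton_union]
      exact (Ideal.eq_top_iff_one _).2 (by
        rw [Ideal.mem_span_pair]
        exact h1)
    rw [h2, mul_zero, pow_zero, Nat.card_eq_one_iff_unique]
    exact ⟨Submodule.Quotient.subsingleton_iff.2 rfl, ⟨0⟩⟩

variable {n : ℕ}

/-- The size of the kernel of `f(B)`. -/
noncomputable def cardKer (B : Matrix (Fin n) (Fin n) F) (f : F[X]) : ℕ :=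
  Nat.card {v : Fin n → F // (aeval B f).mulVec v = 0}

/-- The `F[X]`-module attached to `B` is the product of the `F[X] ⧸ (pᵢ ^ eᵢ)`, where the `pᵢ` are
monic irreducible polynomials and `eᵢ ≠ 0`. -/
structure HasElementaryDivisors (B : Matrix (Fin n) (Fin n) F) {ι : Type*} (p : ι → F[X])
    (e : ι → ℕ) : Prop where
  irreducible : ∀ i, Irreducible (p i)
  monic : ∀ i, (p i).Monic
  ne_zero : ∀ i, e i ≠ 0
  nonempty_equiv : Nonempty
    (AEval' (Matrix.toLin' B) ≃ₗ[F[X]] ∀ i, F[X] ⧸ Ideal.span {p i ^ e i})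

theorem exists_hasElementaryDivisors.{u} {F : Type u} [Field F] (B : Matrix (Fin n) (Fin n) F) :
    ∃ (ι : Type u) (_ : Fintype ι) (p : ι → F[X]) (e : ι → ℕ), HasElementaryDivisors B p e := by
  classical
  have hT := AEval.isTorsion_of_finiteDimensional F (Fin n → F) (Matrix.toLin' B)
  obtain ⟨ι, _, p, hp, e, ⟨E⟩⟩ := Module.equiv_directSum_of_isTorsion hT
  refine ⟨{i // e i ≠ 0}, inferInstance, fun i => normalize (p i), fun i => e i,
    fun i => (associated_normalize (p i)).irreducible (hp i),
    fun i => monic_normalize (hp i).ne_zero, fun i => i.2, ⟨?_⟩⟩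
  have hspan : ∀ i, Ideal.span {p i ^ e i} = Ideal.span {normalize (p i) ^ e i} := fun i =>
    Ideal.span_singleton_eq_span_singleton.2 (associated_normalize (p i)).pow_pow
  let E₁ : AEval' (Matrix.toLin' B) ≃ₗ[F[X]] ∀ i, F[X] ⧸ Ideal.span {normalize (p i) ^ e i} :=
    E ≪≫ₗ DirectSum.linearEquivFunOnFintype _ _ _ ≪≫ₗ
      LinearEquiv.piCongrRight fun i => Submodule.quotEquivOfEq _ _ (hspan i)
  -- The factors with exponent zero are trivial modules.
  let E₂ : (∀ i, F[X] ⧸ Ideal.span {normalize (p i) ^ e i}) →ₗ[F[X]]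
      ∀ i : {i // e i ≠ 0}, F[X] ⧸ Ideal.span {normalize (p i) ^ e i} :=
    LinearMap.pi fun i => LinearMap.proj i.1
  have hsub : ∀ i, e i = 0 → Subsingleton (F[X] ⧸ Ideal.span {normalize (p i) ^ e i}) := by
    intro i hi
    rw [Submodule.Quotient.subsingleton_iff, hi, pow_zero, Ideal.span_singleton_one]
  have hE₂ : Function.Bijective E₂ := by
    constructor
    · intro x y hxy
      funext i
      by_cases hi : e i = 0
      · exact (hsub i hi).elim _ _
      · exact congrFun hxy ⟨i, hi⟩
    · intro y
      refine ⟨fun i => if hi : e i = 0 then 0 else y ⟨i, hi⟩, ?_⟩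
      funext i
      exact dif_neg i.2
  exact E₁ ≪≫ₗ LinearEquiv.ofBijective E₂ hE₂

theorem aeval_toLin'_apply (B : Matrix (Fin n) (Fin n) F) (f : F[X]) (v : Fin n → F) :
    aeval (Matrix.toLin' B) f v = (aeval B f).mulVec v := by
  have h := aeval_algHom_apply
    (Matrix.toLinAlgEquiv' : Matrix (Fin n) (Fin n) F ≃ₐ[F] _).toAlgHom B f
  have h2 := congrArg (fun φ : (Fin n → F) →ₗ[F] (Fin n → F) => φ v) h
  exact h2

variable [Finite F]

open Classical in
theorem HasElementaryDivisors.cardKer_pow {B : Matrix (Fin n) (Fin n) F} {ι : Type*} [Fintype ι]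
    {p : ι → F[X]} {e : ι → ℕ} (h : HasElementaryDivisors B p e) {π : F[X]} (hπ : Irreducible π)
    (k : ℕ) :
    cardKer B (π ^ k) =
      Nat.card F ^ (π.natDegree * ∑ i, if Associated π (p i) then min (e i) k else 0) := by
  obtain ⟨E⟩ := h.nonempty_equiv
  have e1 : {v : Fin n → F // (aeval B (π ^ k)).mulVec v = 0} ≃
      {x : ∀ i, F[X] ⧸ Ideal.span {p i ^ e i} // ∀ i, π ^ k • x i = 0} := by
    refine Equiv.subtypeEquiv ((AEval'.of (Matrix.toLin' B)).toEquiv.trans E.toEquiv) fun v => ?_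
    have h1 : (∀ i, π ^ k • (E (AEval'.of (Matrix.toLin' B) v)) i = 0) ↔
        π ^ k • E (AEval'.of (Matrix.toLin' B) v) = 0 := by
      rw [funext_iff]; rfl
    rw [← aeval_toLin'_apply]
    refine Iff.trans ?_ h1.symm
    rw [← map_smul, E.map_eq_zero_iff, ← AEval.of_aeval_smul, LinearEquiv.map_eq_zero_iff]
    rfl
  rw [cardKer,
    Nat.card_congr (e1.trans (Equiv.subtypePiEquivPi (p := fun i x => π ^ k • x = 0))), Nat.card_pi,
    Finset.prod_congr rfl fun i _ =>
      card_ker_pow_smul_quotient (h.irreducible i) (h.monic i) hπ _ _,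
    Finset.prod_pow_eq_pow_sum, Finset.mul_sum]

theorem HasElementaryDivisors.sum_mul_natDegree {B : Matrix (Fin n) (Fin n) F} {ι : Type*}
    [Fintype ι] {p : ι → F[X]} {e : ι → ℕ} (h : HasElementaryDivisors B p e) :
    ∑ i, e i * (p i).natDegree = n := by
  obtain ⟨E⟩ := h.nonempty_equiv
  have h1 := Nat.card_congr ((AEval'.of (Matrix.toLin' B)).toEquiv.trans E.toEquiv)
  rw [Nat.card_fun, Nat.card_fin, Nat.card_pi,
    Finset.prod_congr rfl fun i _ => card_quotient_span ((h.monic i).pow (e i)),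
    Finset.prod_pow_eq_pow_sum] at h1
  have h2 := Nat.pow_right_injective Finite.one_lt_card h1
  rw [h2]
  exact Finset.sum_congr rfl fun i _ => by rw [natDegree_pow]

/-- The second difference in `k` of `min f k` is minus the indicator of `f = k + 1`. -/
theorem two_mul_sum_min_succ {κ : Type*} [Fintype κ] (q : κ → Prop) [DecidablePred q] (f : κ → ℕ)
    (k : ℕ) :
    2 * (∑ i, if q i then min (f i) (k + 1) else 0) = (∑ i, if q i then min (f i) k else 0) +
      (∑ i, if q i then min (f i) (k + 2) else 0) +
        (Finset.univ.filter fun i => f i = k + 1 ∧ q i).card := by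
  rw [Finset.card_filter, Finset.mul_sum, ← Finset.sum_add_distrib, ← Finset.sum_add_distrib]
  refine Finset.sum_congr rfl fun i _ => ?_
  by_cases hq : q i
  · simp only [hq, if_true, and_true]
    split_ifs <;> omega
  · simp [hq]

open Classical in
/-- The numbers of elementary divisors can be read off from the kernels of the `π(B) ^ k`, by taking
second differences in `k`. Two matrices and two polynomials are allowed in order to compare `B` with
`ζ B`, where `π(t)` corresponds to `π(ζ t)`. -/
theorem HasElementaryDivisors.card_eq_card {B B' : Matrix (Fin n) (Fin n) F}
    {ι ι' : Type*} [Fintype ι] [Fintype ι'] {p : ι → F[X]} {e : ι → ℕ} {p' : ι' → F[X]}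
    {e' : ι' → ℕ} (h : HasElementaryDivisors B p e) (h' : HasElementaryDivisors B' p' e')
    {π π' : F[X]} (hπ : Irreducible π) (hπ' : Irreducible π') (hd : π.natDegree = π'.natDegree)
    (hk : ∀ k, cardKer B (π ^ k) = cardKer B' (π' ^ k)) (k : ℕ) :
    (Finset.univ.filter fun i => e i = k + 1 ∧ Associated π (p i)).card =
      (Finset.univ.filter fun i => e' i = k + 1 ∧ Associated π' (p' i)).card := by
  have hw : ∀ k, (∑ i, if Associated π (p i) then min (e i) k else 0) =
      ∑ i, if Associated π' (p' i) then min (e' i) k else 0 := by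
    intro k
    have h1 := hk k
    rw [h.cardKer_pow hπ, h'.cardKer_pow hπ', ← hd] at h1
    exact Nat.eq_of_mul_eq_mul_left hπ.natDegree_pos
      (Nat.pow_right_injective Finite.one_lt_card h1)
  have h1 := two_mul_sum_min_succ (fun i => Associated π (p i)) e k
  have h2 := hw k
  have h3 := hw (k + 1)
  have h4 := hw (k + 2)
  rw [h2, h3, h4] at h1
  have h5 := two_mul_sum_min_succ (fun i => Associated π' (p' i)) e' k
  omega

end ElementaryDivisors

/-! ### Similarity classes and sequences of monic polynomials -/

section Layers

open Polynomial Module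

variable {F : Type*} [Field F] {ι : Type*} [Fintype ι]

/-- The product of the `pᵢ` with `eᵢ = j + 1`; the shift makes the exponents, which are never `0`,
match indices that start at `0`. -/
noncomputable def layer (p : ι → F[X]) (e : ι → ℕ) (j : ℕ) : F[X] :=
  ∏ i with e i = j + 1, p i

open Classical in
theorem emultiplicity_layer {p : ι → F[X]} (hp : ∀ i, Irreducible (p i)) (e : ι → ℕ) {π : F[X]}
    (hπ : Irreducible π) (j : ℕ) :
    emultiplicity π (layer p e j) =
      ((Finset.univ.filter fun i => e i = j + 1 ∧ Associated π (p i)).card : ℕ∞) := by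
  have h1 : ∀ i, emultiplicity π (p i) = if Associated π (p i) then 1 else 0 := by
    intro i
    split_ifs with h
    · rw [← emultiplicity_eq_of_associated_right h]
      exact (FiniteMultiplicity.of_not_isUnit hπ.not_isUnit hπ.ne_zero).emultiplicity_self
    · exact emultiplicity_eq_zero.2 fun hd => h (hπ.associated_of_dvd (hp i) hd)
  rw [layer, Finset.emultiplicity_prod hπ.prime, Finset.sum_congr rfl fun i _ => h1 i,
    ← Finset.sum_filter, Finset.filter_filter, Finset.sum_const, nsmul_eq_mul, mul_one]

theorem associated_of_emultiplicity_eq {f g : F[X]} (hf : f ≠ 0) (hg : g ≠ 0)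
    (h : ∀ π, Irreducible π → emultiplicity π f = emultiplicity π g) : Associated f g := by
  classical
  rw [UniqueFactorizationMonoid.associated_iff_normalizedFactors_eq_normalizedFactors hf hg]
  ext π
  by_cases hπ : Irreducible π ∧ normalize π = π
  · have h1 := h π hπ.1
    rw [UniqueFactorizationMonoid.emultiplicity_eq_count_normalizedFactors hπ.1 hf,
      UniqueFactorizationMonoid.emultiplicity_eq_count_normalizedFactors hπ.1 hg, hπ.2] at h1
    exact_mod_cast h1
  · have h2 : ∀ f : F[X], π ∉ UniqueFactorizationMonoid.normalizedFactors f := fun f hm =>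
      hπ ⟨UniqueFactorizationMonoid.irreducible_of_normalized_factor _ hm,
        UniqueFactorizationMonoid.normalize_normalized_factor _ hm⟩
    rw [Multiset.count_eq_zero_of_notMem (h2 f), Multiset.count_eq_zero_of_notMem (h2 g)]

theorem exists_equiv_of_card_fiber_eq {ι ι' α : Type*} [Finite ι] [Finite ι'] (c : ι → α)
    (c' : ι' → α) (h : ∀ a, Nat.card {i // c i = a} = Nat.card {i // c' i = a}) :
    ∃ σ : ι ≃ ι', ∀ i, c' (σ i) = c i := by
  let E : ∀ a, {i // c i = a} ≃ {i // c' i = a} := fun a => (Finite.card_eq.1 (h a)).some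
  refine ⟨(Equiv.sigmaFiberEquiv c).symm.trans ((Equiv.sigmaCongrRight E).trans
    (Equiv.sigmaFiberEquiv c')), fun i => ?_⟩
  exact (E (c i) ⟨i, rfl⟩).2

variable {n : ℕ}

/-- Isomorphic `F[X]`-modules come from similar matrices. -/
theorem exists_conj_eq_of_linearEquiv {B B' : Matrix (Fin n) (Fin n) F}
    (E : AEval' (Matrix.toLin' B) ≃ₗ[F[X]] AEval' (Matrix.toLin' B')) :
    ∃ A : GL (Fin n) F, A.1 * B * A⁻¹.1 = B' := by
  let e : (Fin n → F) ≃ₗ[F] (Fin n → F) :=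
    AEval'.of (Matrix.toLin' B) ≪≫ₗ E.restrictScalars F ≪≫ₗ (AEval'.of (Matrix.toLin' B')).symm
  obtain ⟨A, hA⟩ := exists_GL_mulVec_eq e
  refine ⟨A, ?_⟩
  have h : A.1 * B = B' * A.1 := by
    refine Matrix.toLin'.injective (LinearMap.ext fun v => ?_)
    rw [Matrix.toLin'_mul_apply, Matrix.toLin'_mul_apply, Matrix.toLin'_apply A.1,
      Matrix.toLin'_apply A.1, hA, hA]
    change (AEval'.of (Matrix.toLin' B')).symm (E (AEval'.of (Matrix.toLin' B) _)) =
      Matrix.toLin' B' ((AEval'.of (Matrix.toLin' B')).symm (E (AEval'.of (Matrix.toLin' B) _)))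
    rw [← Matrix.toLin'_apply B v, ← AEval'.X_smul_of, map_smul, AEval'.of_symm_X_smul]
  rw [h, Units.mul_inv_cancel_right]

/-- The layers determine how often each `(p, e)` occurs among the elementary divisors. -/
theorem exists_conj_eq_of_layer_eq {B B' : Matrix (Fin n) (Fin n) F} {ι' : Type*} [Fintype ι']
    {p : ι → F[X]} {e : ι → ℕ} {p' : ι' → F[X]} {e' : ι' → ℕ}
    (h : HasElementaryDivisors B p e) (h' : HasElementaryDivisors B' p' e')
    (hl : ∀ j, layer p e j = layer p' e' j) : ∃ A : GL (Fin n) F, A.1 * B * A⁻¹.1 = B' := by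
  classical
  obtain ⟨σ, hσ⟩ := exists_equiv_of_card_fiber_eq (fun i => (p i, e i)) (fun i => (p' i, e' i)) (by
    rintro ⟨π, k⟩
    simp only [Prod.mk.injEq]
    by_cases hk : k = 0
    · subst hk
      simp only [h.ne_zero, h'.ne_zero, and_false]
      rw [Nat.card_of_isEmpty, Nat.card_of_isEmpty]
    obtain ⟨j, rfl⟩ := Nat.exists_eq_succ_of_ne_zero hk
    by_cases hπ : Irreducible π ∧ π.Monic
    · have h1 := hl j
      have h2 := emultiplicity_layer h.irreducible e hπ.1 j
      have h3 := emultiplicity_layer h'.irreducible e' hπ.1 j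
      rw [h1, h3] at h2
      have h4 := (ENat.natCast_inj.1 h2).symm
      have h5 : ∀ i, Associated π (p i) ↔ p i = π := fun i =>
        ⟨fun ha => (eq_of_monic_of_associated hπ.2 (h.monic i) ha).symm, fun he => he ▸ .refl _⟩
      have h6 : ∀ i, Associated π (p' i) ↔ p' i = π := fun i =>
        ⟨fun ha => (eq_of_monic_of_associated hπ.2 (h'.monic i) ha).symm, fun he => he ▸ .refl _⟩
      simp only [h5, h6] at h4
      rw [Nat.card_eq_fintype_card, Nat.card_eq_fintype_card, Fintype.card_subtype,
        Fintype.card_subtype]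
      simpa only [and_comm] using h4
    · have h1 : ∀ i, p i ≠ π := fun i hi => hπ (hi ▸ ⟨h.irreducible i, h.monic i⟩)
      have h2 : ∀ i, p' i ≠ π := fun i hi => hπ (hi ▸ ⟨h'.irreducible i, h'.monic i⟩)
      simp only [h1, h2, false_and]
      rw [Nat.card_of_isEmpty, Nat.card_of_isEmpty])
  obtain ⟨E⟩ := h.nonempty_equiv
  obtain ⟨E'⟩ := h'.nonempty_equiv
  have hspan : ∀ i, Ideal.span {p i ^ e i} = Ideal.span {p' (σ i) ^ e' (σ i)} := fun i => by
    have := hσ i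
    simp only [Prod.mk.injEq] at this
    rw [this.1, this.2]
  exact exists_conj_eq_of_linearEquiv (E ≪≫ₗ
    (LinearEquiv.piCongrRight fun i => Submodule.quotEquivOfEq _ _ (hspan i)) ≪≫ₗ
    LinearEquiv.piCongrLeft F[X] (fun i' => F[X] ⧸ Ideal.span {p' i' ^ e' i'}) σ ≪≫ₗ E'.symm)

theorem cardKer_conj (A : GL (Fin n) F) (B : Matrix (Fin n) (Fin n) F) (f : F[X]) :
    cardKer (A.1 * B * A⁻¹.1) f = cardKer B f := by
  have h1 : A.1 * aeval B f = aeval (A.1 * B * A⁻¹.1) f * A.1 := by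
    induction f using Polynomial.induction_on' with
    | add f g hf hg => rw [map_add, map_add, mul_add, add_mul, hf, hg]
    | monomial k a =>
      rw [aeval_monomial, aeval_monomial, conj_matrix_pow, ← mul_assoc,
        mul_assoc (algebraMap _ _ _), Units.inv_mul_cancel_right, ← mul_assoc, Algebra.commutes]
  symm
  refine Nat.card_congr (Equiv.subtypeEquiv
    { toFun := fun v => A.1.mulVec v
      invFun := fun v => A⁻¹.1.mulVec v
      left_inv := fun v => by
        dsimp only
        rw [Matrix.mulVec_mulVec, Units.inv_mul, Matrix.one_mulVec]
      right_inv := fun v => by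
        dsimp only
        rw [Matrix.mulVec_mulVec, Units.mul_inv, Matrix.one_mulVec] }
    fun v => ?_)
  change _ ↔ (aeval (A.1 * B * A⁻¹.1) f).mulVec (A.1.mulVec v) = 0
  rw [Matrix.mulVec_mulVec, ← h1, ← Matrix.mulVec_mulVec]
  constructor
  · intro h
    rw [h, Matrix.mulVec_zero]
  · intro h
    have h2 := congrArg (fun x => A⁻¹.1.mulVec x) h
    rwa [Matrix.mulVec_zero, Matrix.mulVec_mulVec, Units.inv_mul, Matrix.one_mulVec] at h2

/-- Sequences `g₁, …, gₙ` of monic polynomials with `∑ j deg gⱼ = n`. They parametrize the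
similarity classes of `n × n` matrices, `gⱼ` being the product of the `p` over all elementary
divisors `p ^ j`. The polynomial `gⱼ` has index `j - 1` in `Fin n`. -/
abbrev LayerData (F : Type*) [Field F] (n : ℕ) : Type _ :=
  {g : Fin n → F[X] // (∀ j, (g j).Monic) ∧ ∑ j : Fin n, ((j : ℕ) + 1) * (g j).natDegree = n}

theorem monic_layer {p : ι → F[X]} (hp : ∀ i, (p i).Monic) (e : ι → ℕ) (j : ℕ) :
    (layer p e j).Monic :=
  monic_prod_of_monic _ _ fun i _ => hp i

theorem natDegree_layer {p : ι → F[X]} (hp : ∀ i, (p i).Monic) (e : ι → ℕ) (j : ℕ) :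
    (layer p e j).natDegree = ∑ i with e i = j + 1, (p i).natDegree :=
  natDegree_prod_of_monic _ _ fun i _ => hp i

section FiniteField

variable [Finite F]

theorem HasElementaryDivisors.exponent_le {B : Matrix (Fin n) (Fin n) F} {p : ι → F[X]} {e : ι → ℕ}
    (h : HasElementaryDivisors B p e) (i : ι) : e i ≤ n := by
  rw [← h.sum_mul_natDegree]
  refine le_trans ?_ (Finset.single_le_sum (f := fun i => e i * (p i).natDegree)
    (fun _ _ => Nat.zero_le _) (Finset.mem_univ i))
  exact Nat.le_mul_of_pos_right _ (h.irreducible i).natDegree_pos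

theorem HasElementaryDivisors.layer_eq_one {B : Matrix (Fin n) (Fin n) F} {p : ι → F[X]}
    {e : ι → ℕ} (h : HasElementaryDivisors B p e) {j : ℕ} (hj : n ≤ j) : layer p e j = 1 := by
  rw [layer, Finset.filter_false_of_mem, Finset.prod_empty]
  intro i _
  have := h.exponent_le i
  omega

theorem HasElementaryDivisors.sum_natDegree_layer {B : Matrix (Fin n) (Fin n) F} {p : ι → F[X]}
    {e : ι → ℕ} (h : HasElementaryDivisors B p e) :
    ∑ j : Fin n, ((j : ℕ) + 1) * (layer p e j).natDegree = n := by
  conv_rhs => rw [← h.sum_mul_natDegree]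
  rw [Fin.sum_univ_eq_sum_range (fun j => (j + 1) * (layer p e j).natDegree),
    ← Finset.sum_fiberwise_of_maps_to (s := Finset.univ) (t := Finset.range n)
      (g := fun i => e i - 1)]
  · refine Finset.sum_congr rfl fun j _ => ?_
    rw [natDegree_layer h.monic, Finset.mul_sum]
    refine Finset.sum_congr ?_ fun i hi => ?_
    · refine Finset.filter_congr fun i _ => ?_
      have := h.ne_zero i
      omega
    · have h1 := (Finset.mem_filter.1 hi).2
      have := h.ne_zero i
      rw [show e i = j + 1 by omega]
  · intro i _
    have := h.ne_zero i
    have := h.exponent_le i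
    rw [Finset.mem_range]
    omega

theorem exists_layerData (B : Matrix (Fin n) (Fin n) F) :
    ∃ (g : LayerData F n) (m : ℕ) (p : Fin m → F[X]) (e : Fin m → ℕ),
      HasElementaryDivisors B p e ∧ ∀ j : Fin n, g.1 j = layer p e j := by
  obtain ⟨ι, _, p, e, h⟩ := exists_hasElementaryDivisors B
  obtain ⟨E⟩ := h.nonempty_equiv
  let σ := (Fintype.equivFin ι).symm
  have h' : HasElementaryDivisors B (p ∘ σ) (e ∘ σ) :=
    ⟨fun i => h.irreducible _, fun i => h.monic _, fun i => h.ne_zero _,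
      ⟨E ≪≫ₗ (LinearEquiv.piCongrLeft F[X] (fun i => F[X] ⧸ Ideal.span {p i ^ e i}) σ).symm⟩⟩
  exact ⟨⟨fun j => layer (p ∘ σ) (e ∘ σ) j, fun j => monic_layer h'.monic _ _,
    h'.sum_natDegree_layer⟩, _, _, _, h', fun _ => rfl⟩

/-- The sequence of monic polynomials attached to a matrix: its `j`-th term is the product of the
`p` over all elementary divisors `p ^ (j + 1)`. -/
noncomputable def layerData (B : Matrix (Fin n) (Fin n) F) : LayerData F n :=
  (exists_layerData B).choose

theorem layerData_spec (B : Matrix (Fin n) (Fin n) F) :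
    ∃ (m : ℕ) (p : Fin m → F[X]) (e : Fin m → ℕ),
      HasElementaryDivisors B p e ∧ ∀ j : Fin n, (layerData B).1 j = layer p e j :=
  (exists_layerData B).choose_spec

theorem exists_conj_eq_of_layerData_eq {B B' : Matrix (Fin n) (Fin n) F}
    (h : layerData B = layerData B') : ∃ A : GL (Fin n) F, A.1 * B * A⁻¹.1 = B' := by
  obtain ⟨m, p, e, hB, h1⟩ := layerData_spec B
  obtain ⟨m', p', e', hB', h2⟩ := layerData_spec B'
  refine exists_conj_eq_of_layer_eq hB hB' fun j => ?_
  by_cases hj : j < n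
  · have h3 := h1 ⟨j, hj⟩
    rw [h, h2 ⟨j, hj⟩] at h3
    exact h3.symm
  · rw [hB.layer_eq_one (not_lt.1 hj), hB'.layer_eq_one (not_lt.1 hj)]

theorem emultiplicity_layerData_eq {B B' : Matrix (Fin n) (Fin n) F} {π π' : F[X]}
    (hπ : Irreducible π) (hπ' : Irreducible π') (hd : π.natDegree = π'.natDegree)
    (hk : ∀ k, cardKer B (π ^ k) = cardKer B' (π' ^ k)) (j : Fin n) :
    emultiplicity π ((layerData B).1 j) = emultiplicity π' ((layerData B').1 j) := by
  classical
  obtain ⟨m, p, e, hB, h1⟩ := layerData_spec B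
  obtain ⟨m', p', e', hB', h2⟩ := layerData_spec B'
  rw [h1, h2, emultiplicity_layer hB.irreducible e hπ, emultiplicity_layer hB'.irreducible e' hπ',
    hB.card_eq_card hB' hπ hπ' hd hk]

theorem layerData_eq_of_hasElementaryDivisors {B : Matrix (Fin n) (Fin n) F} {p : ι → F[X]}
    {e : ι → ℕ} (h : HasElementaryDivisors B p e) (j : Fin n) :
    (layerData B).1 j = layer p e j := by
  classical
  obtain ⟨m', p', e', hB', h2⟩ := layerData_spec B
  refine eq_of_monic_of_associated ((layerData B).2.1 j) (monic_layer h.monic _ _)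
    (associated_of_emultiplicity_eq ((layerData B).2.1 j).ne_zero (monic_layer h.monic _ _).ne_zero
      fun π hπ => ?_)
  rw [h2, emultiplicity_layer hB'.irreducible e' hπ, emultiplicity_layer h.irreducible e hπ,
    hB'.card_eq_card h hπ hπ rfl fun _ => rfl]

theorem layerData_conj (A : GL (Fin n) F) (B : Matrix (Fin n) (Fin n) F) :
    layerData (A.1 * B * A⁻¹.1) = layerData B := by
  refine Subtype.ext (_root_.funext fun j => ?_)
  refine eq_of_monic_of_associated ((layerData _).2.1 j) ((layerData B).2.1 j)
    (associated_of_emultiplicity_eq ((layerData _).2.1 j).ne_zero ((layerData B).2.1 j).ne_zero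
      fun π hπ => ?_)
  exact emultiplicity_layerData_eq hπ hπ rfl (fun k => cardKer_conj A B _) j

/-- Factor the given polynomials and take the product of the corresponding cyclic modules. -/
theorem layerData_surjective :
    Function.Surjective (layerData : Matrix (Fin n) (Fin n) F → LayerData F n) := by
  classical
  intro g
  let l : Fin n → List F[X] := fun j => (UniqueFactorizationMonoid.normalizedFactors (g.1 j)).toList
  have hl : ∀ j q, q ∈ l j → Irreducible q ∧ q.Monic := by
    intro j q hq
    rw [Multiset.mem_toList] at hq
    have h1 := UniqueFactorizationMonoid.irreducible_of_normalized_factor _ hq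
    refine ⟨h1, ?_⟩
    rw [← UniqueFactorizationMonoid.normalize_normalized_factor _ hq]
    exact monic_normalize h1.ne_zero
  let p : (Σ j : Fin n, Fin (l j).length) → F[X] := fun x => (l x.1).get x.2
  let e : (Σ j : Fin n, Fin (l j).length) → ℕ := fun x => x.1 + 1
  have hp : ∀ x, Irreducible (p x) ∧ (p x).Monic := fun x => hl x.1 _ (List.get_mem _ _)
  have hlayer : ∀ j : Fin n, layer p e j = g.1 j := by
    intro j
    rw [layer, Finset.prod_filter, Fintype.prod_sigma, Finset.prod_eq_single j]
    · simp only [e, if_true]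
      change ∏ i, (l j).get i = g.1 j
      rw [← List.prod_ofFn, List.ofFn_get, Multiset.prod_toList,
        UniqueFactorizationMonoid.prod_normalizedFactors_eq (g.2.1 j).ne_zero,
        (g.2.1 j).normalize_eq_self]
    · intro k _ hk
      refine Finset.prod_eq_one fun i _ => if_neg ?_
      simp only [e]
      have : (k : ℕ) ≠ j := fun h => hk (Fin.ext h)
      omega
    · simp
  have : ∀ x, Module.Finite F (F[X] ⧸ Ideal.span {p x ^ e x}) := fun x =>
    ((hp x).2.pow (e x)).finite_quotient
  have hfin : finrank F (Fin n → F) = finrank F (∀ x, F[X] ⧸ Ideal.span {p x ^ e x}) := by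
    rw [finrank_fintype_fun_eq_card, Fintype.card_fin, finrank_pi_fintype]
    simp only [finrank_quotient_span_eq_natDegree, natDegree_pow]
    rw [Fintype.sum_sigma]
    conv_lhs => rw [← g.2.2]
    refine Finset.sum_congr rfl fun j _ => ?_
    have he : ∀ i, e ⟨j, i⟩ = j + 1 := fun _ => rfl
    simp only [he]
    rw [← Finset.mul_sum, ← hlayer j, natDegree_layer fun x => (hp x).2, Finset.sum_filter,
      Fintype.sum_sigma, Finset.sum_eq_single j]
    · simp [e]
    · intro k _ hk
      refine Finset.sum_eq_zero fun i _ => if_neg ?_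
      simp only [e]
      have : (k : ℕ) ≠ j := fun h => hk (Fin.ext h)
      omega
    · simp
  let ψ := LinearEquiv.ofFinrankEq _ _ hfin
  -- Multiplication by `X` on the product of the cyclic modules, in some `F`-basis.
  let φ : (Fin n → F) →ₗ[F] (Fin n → F) :=
    ψ.symm.toLinearMap ∘ₗ (Algebra.lsmul F F (∀ x, F[X] ⧸ Ideal.span {p x ^ e x})
      (Polynomial.X : F[X])) ∘ₗ ψ.toLinearMap
  have hED : HasElementaryDivisors (LinearMap.toMatrix' φ) p e := by
    refine ⟨fun x => (hp x).1, fun x => (hp x).2, fun x => Nat.succ_ne_zero _, ?_⟩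
    rw [Matrix.toLin'_toMatrix']
    exact ⟨LinearEquiv.ofAEval φ ψ fun m => ψ.apply_symm_apply _⟩
  exact ⟨LinearMap.toMatrix' φ, Subtype.ext (_root_.funext fun j => by
    rw [layerData_eq_of_hasElementaryDivisors hED, hlayer])⟩

end FiniteField

/-- The automorphism `f(t) ↦ f(ζ t)` of `F[t]`. -/
noncomputable def scaleEquiv {ζ : F} (hζ : ζ ≠ 0) : F[X] ≃ₐ[F] F[X] :=
  letI := invertibleOfNonzero hζ
  algEquivCMulXAddC ζ 0

theorem scaleEquiv_apply {ζ : F} (hζ : ζ ≠ 0) (f : F[X]) :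
    scaleEquiv hζ f = f.comp (Polynomial.C ζ * Polynomial.X) := by
  simp [scaleEquiv, comp, aeval_def]

theorem aeval_scaleEquiv {ζ : F} (hζ : ζ ≠ 0) (B : Matrix (Fin n) (Fin n) F) (f : F[X]) :
    aeval B (scaleEquiv hζ f) = aeval (ζ • B) f := by
  rw [scaleEquiv_apply, aeval_comp]
  simp [Algebra.smul_def]

theorem natDegree_scaleEquiv {ζ : F} (hζ : ζ ≠ 0) (f : F[X]) :
    (scaleEquiv hζ f).natDegree = f.natDegree := by
  rw [scaleEquiv_apply, natDegree_comp, natDegree_C_mul_X _ hζ, mul_one]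

/-- A matrix `B` is similar to `ζ B` if and only if the associated monic polynomials are invariant,
up to scalars, under `t ↦ ζ t`. -/
theorem exists_conj_eq_smul_iff [Finite F] {ζ : F} (hζ : ζ ≠ 0) (B : Matrix (Fin n) (Fin n) F) :
    (∃ A : GL (Fin n) F, A.1 * B * A⁻¹.1 = ζ • B) ↔
      ∀ j, Associated (scaleEquiv hζ ((layerData B).1 j)) ((layerData B).1 j) := by
  -- `π(ζ B)` is the value at `B` of the polynomial `π(ζ t)`.
  have key : ∀ π, Irreducible π → ∀ j, emultiplicity π ((layerData (ζ • B)).1 j) =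
      emultiplicity (scaleEquiv hζ π) ((layerData B).1 j) := by
    intro π hπ j
    refine emultiplicity_layerData_eq hπ ((MulEquiv.irreducible_iff (scaleEquiv hζ)).2 hπ)
      (natDegree_scaleEquiv hζ π).symm (fun k => ?_) j
    rw [cardKer, cardKer, ← map_pow, aeval_scaleEquiv]
  have hne : ∀ j, (layerData B).1 j ≠ 0 := fun j => ((layerData B).2.1 j).ne_zero
  have hne' : ∀ j, scaleEquiv hζ ((layerData B).1 j) ≠ 0 := fun j =>
    (map_ne_zero_iff _ (scaleEquiv hζ).injective).2 (hne j)
  constructor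
  · rintro ⟨A, hA⟩ j
    refine associated_of_emultiplicity_eq (hne' j) (hne j) fun π hπ => ?_
    obtain ⟨π, rfl⟩ := (scaleEquiv hζ).surjective π
    have hπ' := (MulEquiv.irreducible_iff (scaleEquiv hζ)).1 hπ
    rw [emultiplicity_map_eq, ← key π hπ', ← hA, layerData_conj]
  · intro h
    refine exists_conj_eq_of_layerData_eq (Subtype.ext (_root_.funext fun j => ?_))
    refine eq_of_monic_of_associated ((layerData _).2.1 j) ((layerData _).2.1 j)
      (associated_of_emultiplicity_eq (hne j) ((layerData _).2.1 j).ne_zero fun π hπ => ?_)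
    rw [key π hπ]
    conv_rhs => rw [← emultiplicity_eq_of_associated_right (h j), emultiplicity_map_eq]

end Layers

/-! ### Counting invariant similarity classes -/

section Orbits

variable {F : Type*} [Field F]

/-- The pairs `(A, B)` in `U` with `B` in the similarity class of a given `B₀` are as many as the
elements of the general linear group if `B₀` is similar to `ζ B₀`, and there are none otherwise. -/
theorem card_U_conj_class [Finite F] (ζ : F) {n : ℕ} (B₀ : Matrix (Fin n) (Fin n) F)
    [Decidable (∃ A : GL (Fin n) F, A.1 * B₀ * A⁻¹.1 = ζ • B₀)] :
    Nat.card {P : Matrix (Fin n) (Fin n) F × Matrix (Fin n) (Fin n) F |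
        P ∈ U ζ n ∧ ∃ h : GL (Fin n) F, h.1 * B₀ * h⁻¹.1 = P.2} =
      if ∃ A : GL (Fin n) F, A.1 * B₀ * A⁻¹.1 = ζ • B₀ then Nat.card (GL (Fin n) F) else 0 := by
  have hiff : ∀ (A : GL (Fin n) F) (B : Matrix (Fin n) (Fin n) F),
      A.1 * B = ζ • (B * A.1) ↔ A.1 * B * A⁻¹.1 = ζ • B := by
    intro A B
    rw [Units.mul_inv_eq_iff_eq_mul, Matrix.smul_mul]
  have hmul : ∀ (g h : GL (Fin n) F) (B : Matrix (Fin n) (Fin n) F),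
      g.1 * (h.1 * B * h⁻¹.1) * g⁻¹.1 = (g * h).1 * B * (g * h)⁻¹.1 := by
    intro g h B
    rw [mul_inv_rev, Units.val_mul, Units.val_mul]
    simp only [mul_assoc]
  split_ifs with hC
  · obtain ⟨A₀, hA₀⟩ := hC
    -- The first entries of the pairs in the slice `B = B₀` form a coset of the centralizer of `B₀`,
    -- which is also the group of elements that preserve the slice.
    have key := card_mul_card_slice (conjPair (F := F) (ι := Fin n))
      (S := {P | P ∈ U ζ n ∧ ∃ h : GL (Fin n) F, h.1 * B₀ * h⁻¹.1 = P.2})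
      (S₀ := {P | P ∈ U ζ n ∧ P.2 = B₀}) (P := {g | g.1 * B₀ * g⁻¹.1 = B₀}) ?_ ?_ ?_ ?_
    · have e : {P : Matrix (Fin n) (Fin n) F × Matrix (Fin n) (Fin n) F |
          P ∈ U ζ n ∧ P.2 = B₀} ≃ {g : GL (Fin n) F | g.1 * B₀ * g⁻¹.1 = B₀} :=
        { toFun := fun P => ⟨A₀⁻¹ * P.2.1.2.unit, by
            obtain ⟨⟨A, B⟩, ⟨h1, h2⟩, h3⟩ := P
            dsimp only at h3
            subst h3
            have h4 := (hiff h2.unit _).1 h1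
            change (A₀⁻¹ * h2.unit).1 * B * (A₀⁻¹ * h2.unit)⁻¹.1 = B
            rw [← hmul, h4, ← hA₀, hmul]
            simp⟩
          invFun := fun g => ⟨((A₀ * g.1).1, B₀), ⟨(hiff _ _).2 (by
            have h := g.2
            change g.1.1 * B₀ * g.1⁻¹.1 = B₀ at h
            rw [← hmul, h, hA₀]), (A₀ * g.1).isUnit⟩, rfl⟩
          left_inv := fun P => by
            obtain ⟨⟨A, B⟩, ⟨h1, h2⟩, h3⟩ := P
            dsimp only at h3
            subst h3
            simp
          right_inv := fun g => by
            apply Subtype.ext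
            apply Units.ext
            simp }
      have hpos : 0 < Nat.card {g : GL (Fin n) F | g.1 * B₀ * g⁻¹.1 = B₀} := by
        have : Nonempty {g : GL (Fin n) F | g.1 * B₀ * g⁻¹.1 = B₀} := ⟨1, by simp⟩
        exact Nat.card_pos
      rw [Nat.card_congr e] at key
      exact (Nat.eq_of_mul_eq_mul_right hpos key).symm
    · rintro g P ⟨⟨h1, h2⟩, h, h3⟩
      exact ⟨⟨conj_zetaCommute g h1, (g.isUnit.mul h2).mul g⁻¹.isUnit⟩, g * h, by
        rw [← hmul, h3, conjPair_snd]⟩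
    · rintro P ⟨hP, h3⟩
      exact ⟨hP, 1, by simp [h3]⟩
    · rintro P ⟨⟨h1, h2⟩, h, h3⟩
      exact ⟨h⁻¹, ⟨conj_zetaCommute _ h1, (h⁻¹.isUnit.mul h2).mul h⁻¹⁻¹.isUnit⟩, by
        rw [conjPair_snd, ← h3, hmul]; simp⟩
    · rintro P ⟨⟨h1, h2⟩, h3⟩ g
      constructor
      · rintro ⟨-, h4⟩
        rwa [conjPair_snd, h3] at h4
      · intro hg
        exact ⟨⟨conj_zetaCommute g h1, (g.isUnit.mul h2).mul g⁻¹.isUnit⟩, by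
          rw [conjPair_snd, h3]; exact hg⟩
  · have : IsEmpty {P : Matrix (Fin n) (Fin n) F × Matrix (Fin n) (Fin n) F |
        P ∈ U ζ n ∧ ∃ h : GL (Fin n) F, h.1 * B₀ * h⁻¹.1 = P.2} := by
      refine ⟨?_⟩
      rintro ⟨⟨A, B⟩, ⟨h1, h2⟩, h, h3⟩
      dsimp only at h3
      have h4 := (hiff h2.unit _).1 h1
      refine hC ⟨h⁻¹ * (h2.unit * h), ?_⟩
      rw [← hmul, ← hmul, h3]
      change h⁻¹.1 * (h2.unit.1 * B * h2.unit⁻¹.1) * h⁻¹⁻¹.1 = ζ • B₀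
      rw [h4, ← h3, Matrix.mul_smul, Matrix.smul_mul, hmul]
      simp
    exact Nat.card_of_isEmpty

/-- `|U| / |GL|` is the number of similarity classes of matrices `B` with `B` similar to `ζ B`. -/
theorem card_U_eq [Finite F] {ζ : F} (hζ : ζ ≠ 0) (n : ℕ) :
    Nat.card (U ζ n) = Nat.card {g : LayerData F n //
      ∀ j, Associated (scaleEquiv hζ (g.1 j)) (g.1 j)} * Nat.card (GL (Fin n) F) := by
  classical
  have : Finite (LayerData F n) := Finite.of_surjective _ (layerData_surjective (F := F) (n := n))
  have := Fintype.ofFinite (LayerData F n)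
  have hfib : ∀ g : LayerData F n, Nat.card {P : U ζ n // layerData P.1.2 = g} =
      if ∀ j, Associated (scaleEquiv hζ (g.1 j)) (g.1 j) then Nat.card (GL (Fin n) F) else 0 := by
    intro g
    obtain ⟨B₀, rfl⟩ := layerData_surjective g
    rw [← if_congr (exists_conj_eq_smul_iff hζ B₀) rfl rfl, ← card_U_conj_class ζ B₀]
    refine Nat.card_congr ((Equiv.subtypeSubtypeEquivSubtypeInter (fun P => P ∈ U ζ n)
      (fun P => layerData P.2 = layerData B₀)).trans (Equiv.subtypeEquivRight fun P => ?_))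
    refine and_congr_right fun _ => ⟨fun h => exists_conj_eq_of_layerData_eq h.symm, ?_⟩
    rintro ⟨h, h1⟩
    rw [← h1, layerData_conj]
  rw [← Nat.card_congr (Equiv.sigmaFiberEquiv fun P : U ζ n => layerData P.1.2), Nat.card_sigma,
    Finset.sum_congr rfl fun g _ => hfib g, ← Finset.sum_filter, Finset.sum_const, smul_eq_mul,
    Nat.card_eq_fintype_card (α := {g : LayerData F n // _}), Fintype.card_subtype]

end Orbits

/-! ### Generating functions for invariant polynomials -/

section Counting

/-- Pairs of total weight `n`, split according to the two weights. -/
def subtypeAddEqEquiv {α β : Type*} (u : α → ℕ) (v : β → ℕ) (n : ℕ) :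
    {x : α × β // u x.1 + v x.2 = n} ≃
      Σ p : Finset.HasAntidiagonal.antidiagonal n, {a // u a = p.1.1} × {b // v b = p.1.2} where
  toFun x := ⟨⟨(u x.1.1, v x.1.2), Finset.HasAntidiagonal.mem_antidiagonal.2 x.2⟩,
    ⟨x.1.1, rfl⟩, ⟨x.1.2, rfl⟩⟩
  invFun y := ⟨(y.2.1.1, y.2.2.1), by
    rw [y.2.1.2, y.2.2.2]
    exact Finset.HasAntidiagonal.mem_antidiagonal.1 y.1.2⟩
  left_inv _ := rfl
  right_inv := by
    rintro ⟨⟨⟨a, b⟩, hp⟩, ⟨x, hx⟩, ⟨y, hy⟩⟩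
    dsimp only at hx hy
    subst hx hy
    rfl

/-- Weighted tuples: if `deg` has finite fibres with generating function `f(x)`, then
`f(x) f(x²) ⋯ f(xᵏ)` counts the `k`-tuples `(g₁, …, gₖ)` by `∑ j deg gⱼ`. -/
theorem card_weighted_tuples {I : Type*} (deg : I → ℕ) (hfin : ∀ d, Finite {f // deg f = d})
    (k n : ℕ) :
    Finite {g : Fin k → I // ∑ j : Fin k, ((j : ℕ) + 1) * deg (g j) = n} ∧
      (Nat.card {g : Fin k → I // ∑ j : Fin k, ((j : ℕ) + 1) * deg (g j) = n} : ℝ) =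
        coeff n (∏ i ∈ Finset.range k, expand (i + 1) i.succ_ne_zero
          (PowerSeries.mk fun d => (Nat.card {f // deg f = d} : ℝ))) := by
  induction k generalizing n with
  | zero =>
    refine ⟨inferInstance, ?_⟩
    simp only [Finset.univ_eq_empty, Finset.sum_empty, Finset.range_zero, Finset.prod_empty,
      coeff_one]
    split_ifs with h
    · subst h
      simp
    · have : IsEmpty {g : Fin 0 → I // 0 = n} := ⟨fun g => h g.2.symm⟩
      simp
  | succ k ih =>
    have hlast : ∀ b, Finite {f : I // (k + 1) * deg f = b} ∧
        (Nat.card {f : I // (k + 1) * deg f = b} : ℝ) = coeff b (expand (k + 1) k.succ_ne_zero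
          (PowerSeries.mk fun d => (Nat.card {f // deg f = d} : ℝ))) := by
      intro b
      rw [coeff_expand]
      split_ifs with h
      · obtain ⟨d, rfl⟩ := h
        rw [Nat.mul_div_cancel_left _ k.succ_pos, coeff_mk]
        have e : {f : I // (k + 1) * deg f = (k + 1) * d} ≃ {f : I // deg f = d} :=
          Equiv.subtypeEquivRight fun f => Nat.mul_right_inj k.succ_ne_zero
        have := hfin d
        exact ⟨Finite.of_equiv _ e.symm, by rw [Nat.card_congr e]⟩
      · have : IsEmpty {f : I // (k + 1) * deg f = b} := ⟨fun f => h ⟨_, f.2.symm⟩⟩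
        exact ⟨inferInstance, by simp⟩
    let e₀ : (Fin (k + 1) → I) ≃ (Fin k → I) × I :=
      { toFun := fun g => (fun j => g j.castSucc, g (Fin.last k))
        invFun := fun x => Fin.snoc (α := fun _ => I) x.1 x.2
        left_inv := fun g => Fin.snoc_init_self g
        right_inv := fun x => by simp }
    have e : {g : Fin (k + 1) → I // ∑ j : Fin (k + 1), ((j : ℕ) + 1) * deg (g j) = n} ≃
        Σ p : Finset.HasAntidiagonal.antidiagonal n,
          {g : Fin k → I // ∑ j : Fin k, ((j : ℕ) + 1) * deg (g j) = p.1.1} ×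
            {f : I // (k + 1) * deg f = p.1.2} :=
      (Equiv.subtypeEquiv e₀ fun g => by rw [Fin.sum_univ_castSucc]; rfl).trans
        (subtypeAddEqEquiv (fun g : Fin k → I => ∑ j : Fin k, ((j : ℕ) + 1) * deg (g j))
          (fun f => (k + 1) * deg f) n)
    have h1 : ∀ p : Finset.HasAntidiagonal.antidiagonal n, Finite
        {g : Fin k → I // ∑ j : Fin k, ((j : ℕ) + 1) * deg (g j) = p.1.1} := fun p => (ih _).1
    have h2 : ∀ p : Finset.HasAntidiagonal.antidiagonal n, Finite
        {f : I // (k + 1) * deg f = p.1.2} := fun p => (hlast _).1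
    refine ⟨Finite.of_equiv _ e.symm, ?_⟩
    rw [Nat.card_congr e, Nat.card_sigma, Finset.prod_range_succ, coeff_mul, Nat.cast_sum,
      ← Finset.sum_coe_sort (Finset.HasAntidiagonal.antidiagonal n)]
    refine Finset.sum_congr rfl fun p _ => ?_
    rw [Nat.card_prod, Nat.cast_mul, (ih _).2, (hlast _).2]

open Polynomial

variable {F : Type*} [Field F]

/-- The factor between `f(ζ t)` and `f(t)` can only be `ζ ^ deg f`, as the leading coefficients
show. -/
theorem associated_scaleEquiv_iff {ζ : F} (hζ : ζ ≠ 0) {f : F[X]} (hf : f.Monic) :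
    Associated (scaleEquiv hζ f) f ↔
      ∀ k : Fin f.natDegree, ¬ orderOf ζ ∣ f.natDegree - k → f.coeff k = 0 := by
  have hcoeff : ∀ k, (scaleEquiv hζ f).coeff k = f.coeff k * ζ ^ k := fun k => by
    rw [scaleEquiv_apply, comp_C_mul_X_coeff]
  have hone : ∀ k ≤ f.natDegree, ζ ^ k = ζ ^ f.natDegree ↔ orderOf ζ ∣ f.natDegree - k := by
    intro k hk
    rw [orderOf_dvd_iff_pow_eq_one]
    conv_lhs => rw [← Nat.add_sub_cancel' hk, pow_add]
    rw [left_eq_mul₀ (pow_ne_zero k hζ)]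
  have hiff : Associated (scaleEquiv hζ f) f ↔
      scaleEquiv hζ f = Polynomial.C (ζ ^ f.natDegree) * f := by
    constructor
    · intro h
      obtain ⟨u, hu⟩ := h.symm
      obtain ⟨r, hr, hru⟩ := Polynomial.isUnit_iff.1 u.isUnit
      rw [← hru, mul_comm] at hu
      have h1 := congrArg (fun g => g.coeff f.natDegree) hu
      simp only [Polynomial.coeff_C_mul, hcoeff, hf.coeff_natDegree, mul_one, one_mul] at h1
      rw [← hu, h1]
    · intro h
      rw [h]
      exact (associated_isUnit_mul_left_iff (Polynomial.isUnit_C.2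
        (IsUnit.mk0 _ (pow_ne_zero _ hζ)))).2 (Associated.refl _)
  rw [hiff, Polynomial.ext_iff]
  simp only [hcoeff, Polynomial.coeff_C_mul]
  constructor
  · intro h k hk
    by_contra hne
    refine hk ((hone k k.2.le).1 ?_)
    have := h k
    rw [mul_comm] at this
    exact mul_right_cancel₀ hne this
  · intro h k
    rcases lt_trichotomy k f.natDegree with hk | hk | hk
    · by_cases hd : orderOf ζ ∣ f.natDegree - k
      · rw [(hone k hk.le).2 hd, mul_comm]
      · rw [h ⟨k, hk⟩ hd, zero_mul, mul_zero]
    · rw [hk, mul_comm]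
    · rw [coeff_eq_zero_of_natDegree_lt hk, zero_mul, mul_zero]

theorem card_filter_dvd_sub (m d : ℕ) :
    Nat.card {k : Fin d // m ∣ d - k} = d / m := by
  classical
  rw [← Nat.Ioc_filter_dvd_card_eq_div, Nat.card_eq_fintype_card, ← Fintype.card_coe]
  refine Fintype.card_congr
    { toFun := fun k => ⟨d - k.1, by
        have := k.1.2
        rw [Finset.mem_filter, Finset.mem_Ioc]
        exact ⟨by omega, k.2⟩⟩
      invFun := fun x => ⟨⟨d - x.1, by
        have := Finset.mem_Ioc.1 (Finset.mem_filter.1 x.2).1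
        omega⟩, by
        have h := Finset.mem_filter.1 x.2
        have h1 := Finset.mem_Ioc.1 h.1
        change m ∣ d - (d - x.1)
        rw [Nat.sub_sub_self h1.2]
        exact h.2⟩
      left_inv := fun k => by
        have := k.1.2
        ext
        change d - (d - (k.1 : ℕ)) = k.1
        omega
      right_inv := fun x => by
        have := Finset.mem_Ioc.1 (Finset.mem_filter.1 x.2).1
        ext
        change d - (d - x.1) = x.1
        omega }

/-- Monic polynomials `f` of degree `d` with `f(ζ t)` proportional to `f(t)`: only the coefficients
of `t ^ k` with `k ≡ d` modulo the order of `ζ` are free. -/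
theorem card_invariant_monic [Finite F] {ζ : F} (hζ : ζ ≠ 0) (d : ℕ) :
    Finite {f : {f : F[X] // f.Monic ∧ Associated (scaleEquiv hζ f) f} // f.1.natDegree = d} ∧
      Nat.card {f : {f : F[X] // f.Monic ∧ Associated (scaleEquiv hζ f) f} // f.1.natDegree = d} =
        Nat.card F ^ (d / orderOf ζ) := by
  let e₁ : {f : {f : F[X] // f.Monic ∧ Associated (scaleEquiv hζ f) f} // f.1.natDegree = d} ≃
      {f : {f : F[X] // f.Monic ∧ f.natDegree = d} //
        ∀ k : Fin d, ¬ orderOf ζ ∣ d - k → f.1.coeff k = 0} :=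
    { toFun := fun f => ⟨⟨f.1.1, f.1.2.1, f.2⟩, by
        obtain ⟨⟨f, hf, ha⟩, rfl⟩ := f
        exact (associated_scaleEquiv_iff hζ hf).1 ha⟩
      invFun := fun f => ⟨⟨f.1.1, f.1.2.1, by
        obtain ⟨⟨f, hf, rfl⟩, ha⟩ := f
        exact (associated_scaleEquiv_iff hζ hf).2 ha⟩, f.1.2.2⟩
      left_inv := fun _ => rfl
      right_inv := fun _ => rfl }
  let e₂ : {f : {f : F[X] // f.Monic ∧ f.natDegree = d} //
        ∀ k : Fin d, ¬ orderOf ζ ∣ d - k → f.1.coeff k = 0} ≃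
      {c : Fin d → F // ∀ k : Fin d, ¬ orderOf ζ ∣ d - k → c k = 0} :=
    Equiv.subtypeEquiv ((monicEquivDegreeLT d).trans (degreeLTEquiv F d).toEquiv) fun f => by
      refine forall_congr' fun k => ?_
      have h : ((monicEquivDegreeLT d).trans (degreeLTEquiv F d).toEquiv) f k = f.1.coeff k := by
        change f.1.eraseLead.coeff k = f.1.coeff k
        exact eraseLead_coeff_of_ne _ (by rw [f.2.2]; exact k.2.ne)
      rw [h]
  classical
  let e₃ : {c : Fin d → F // ∀ k : Fin d, ¬ orderOf ζ ∣ d - k → c k = 0} ≃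
      ({k : Fin d // orderOf ζ ∣ d - k} → F) :=
    { toFun := fun c k => c.1 k
      invFun := fun c => ⟨fun k => if h : orderOf ζ ∣ d - k then c ⟨k, h⟩ else 0,
        fun k hk => dif_neg hk⟩
      left_inv := fun c => by
        ext k
        by_cases h : orderOf ζ ∣ d - k
        · simp [h]
        · simp [h, c.2 k h]
      right_inv := fun c => by
        ext k
        simp [k.2] }
  let e := e₁.trans (e₂.trans e₃)
  exact ⟨Finite.of_equiv _ e.symm, by rw [Nat.card_congr e, Nat.card_fun, card_filter_dvd_sub]⟩

theorem hasProd_expand_G [Fintype F] {ζ : F} (hζ : ζ ≠ 0) :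
    HasProd (fun i : ℕ => PowerSeries.expand (i + 1) i.succ_ne_zero
      (G (orderOf ζ) (Fintype.card F))) (genFun (U ζ)) := by
  have hm : 0 < orderOf ζ := by
    have h := orderOf_pos (Units.mk0 ζ hζ)
    rwa [← orderOf_units] at h
  have hG : G (orderOf ζ) (Fintype.card F) = PowerSeries.mk fun d => (Nat.card
      {f : {f : F[X] // f.Monic ∧ Associated (scaleEquiv hζ f) f} // f.1.natDegree = d} : ℝ) := by
    rw [G_eq_mk hm]
    congr 1
    funext d
    rw [(card_invariant_monic hζ d).2, Nat.card_eq_fintype_card, Nat.cast_pow]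
  refine hasProd_of_coeff_eq (fun i => X_pow_dvd_expand_sub_one ?_ _) fun n => ?_
  · rw [G_eq_mk hm, ← coeff_zero_eq_constantCoeff_apply, coeff_mk, Nat.zero_div, pow_zero]
  · rw [hG, ← (card_weighted_tuples (fun f : {f : F[X] // f.Monic ∧
      Associated (scaleEquiv hζ f) f} => f.1.natDegree)
        (fun d => (card_invariant_monic hζ d).1) n n).2, genFun, PowerSeries.coeff_mk, card_U_eq hζ,
      Nat.cast_mul, mul_div_cancel_right₀ _ (card_GL_pos n).ne']
    congr 1
    exact Nat.card_congr
      { toFun := fun g => ⟨fun j => ⟨g.1.1 j, g.1.2.1 j, g.2 j⟩, g.1.2.2⟩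
        invFun := fun g => ⟨⟨fun j => (g.1 j).1, fun j => (g.1 j).2.1, g.2⟩, fun j => (g.1 j).2.2⟩
        left_inv := fun _ => rfl
        right_inv := fun _ => rfl }

end Counting

end ZetaCommuting

theorem theorem1 {F : Type*} [Field F] [Fintype F] (ζ : F) (hζ : ζ ≠ 0) :
    -- (a)
    ZetaCommuting.genFun (ZetaCommuting.K ζ) =
        ZetaCommuting.genFun (ZetaCommuting.U ζ) * ZetaCommuting.genFun (ZetaCommuting.N ζ) ∧
    -- (b); `PowerSeries.expand k` sends `f(x)` to `f(x ^ k)`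
    HasProd (fun i : ℕ => PowerSeries.expand (i + 1) i.succ_ne_zero
        (ZetaCommuting.G (orderOf ζ) (Fintype.card F)))
      (ZetaCommuting.genFun (ZetaCommuting.U ζ)) ∧
    -- (c)
    (Multipliable (ZetaCommuting.HFactor (Fintype.card F)) ∧
      HasProd (fun i : ℕ => PowerSeries.expand (i + 1) i.succ_ne_zero
          (ZetaCommuting.H (Fintype.card F)))
        (ZetaCommuting.genFun (ZetaCommuting.N ζ)) ∧
      ∀ (ξ : F), ξ ≠ 0 → ∀ n : ℕ,
        Nat.card (ZetaCommuting.N ζ n) = Nat.card (ZetaCommuting.N ξ n)) :=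
  ⟨ZetaCommuting.genFun_K_eq_mul hζ, ZetaCommuting.hasProd_expand_G hζ,
    (ZetaCommuting.hasProd_HFactor Fintype.one_lt_card).multipliable,
    ZetaCommuting.hasProd_expand_H hζ, fun _ hξ n => ZetaCommuting.card_N_eq_card_N hζ hξ n⟩
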